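/- Let $X$ be a real or complex Banach space, $\mathbb N=\{1,2,\dots\}$, and let $\mu=(\mu_n)_{n\ge 0}$ be a discrete growth rate: $\mu_n>0$, $\mu$ is strictly increasing, $\mu_0=1$ and $\mu_n\to+\infty$. Assume that there is $\theta\ge 1$ with $\mu_{n+1}/\mu_n\le\theta$ for all $n\ge 0$. Let $(A_n)_{n\in\mathbb N}$ be bounded linear operators on $X$. Let $\varepsilon\ge 0$ and suppose that $(A_n)_{n\in\mathbb N}$ admits a strong nonuniform $\mu$-dichotomy with exponent $\varepsilon$. That is, each $A_n$ is invertible and there are projections $P_k$ ($k\in\mathbb N$) on $X$ and constants $N\ge 1$, $\tilde\nu\ge\nu>0$ such that $A_kP_k=P_{k+1}A_k$ for all $k\in\mathbb N$ and, writing $\Phi(m,k)=A_{m-1}\cdots A_k$ for $m>k$, $\Phi(k,k)=\mathrm{Id}$ and $\Phi(m,k)=\Phi(k,m)^{-1}$ for $m<k$, $$\|\Phi(m,k)P_k\|\le N\Big(\frac{\mu_m}{\mu_k}\Big)^{-\nu}\mu_k^{\varepsilon},\qquad \|\Phi(m,k)(\mathrm{Id}-P_k)\|\le N\Big(\frac{\mu_m}{\mu_k}\Big)^{\tilde\nu}\mu_k^{\varepsilon}\qquad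 (m\ge k\ge 1),$$ $$\|\Phi(m,k)(\mathrm{Id}-P_k)\|\le N\Big(\frac{\mu_k}{\mu_m}\Big)^{-\nu}\mu_k^{\varepsilon},\qquad \|\Phi(m,k)P_k\|\le N\Big(\frac{\mu_k}{\mu_m}\Big)^{\tilde\nu}\mu_k^{\varepsilon}\qquad (1\le m\le k).$$ Then there is $c_0>0$, not depending on the $g_n$, $M$ and $c$ below, with the following property. Let $g_n\colon X\to X$ ($n\in\mathbb N$) be maps and let $M>0$ and $0<c\le c_0$ be such that, with $\mu_n'=\mu_{n+1}-\mu_n$, $$\|g_n(x)\|\le M\mu_n'\mu_n^{-(1+\varepsilon)},\qquad \|g_n(x)-g_n(y)\|\le c\,\mu_n'\mu_n^{-(1+\varepsilon)}\|x-y\|\qquad\text{for all } n\in\mathbb N,\ x,y\in X.$$ Then there is a sequence of homeomorphisms $h_n\colon X\to X$ ($n\in\mathbb N$) such that: 1. $h_{n+1}\circ(A_n+g_n)=A_n\circ h_n$ for every $n\in\mathbb N$; 2. there is $D>0$ with $\|h_n(x)-x\|\le D$ and $\|h_n^{-1}(x)-x\|\le D$ for all $n\in\mathbb N$ and $x\in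 X$; 3. there are $\bar K,\varrho,\delta>0$ such that $$\|h_n(x)-h_n(y)\|\le\bar K\mu_n^{\varrho\varepsilon}\|x-y\|^{\varrho}\quad\text{and}\quad\|h_n^{-1}(x)-h_n^{-1}(y)\|\le\bar K\mu_n^{\varrho\varepsilon}\|x-y\|^{\varrho}$$ for all $n\in\mathbb N$ and all $x,y\in X$ with $\|x-y\|\le\delta\mu_n^{-\varepsilon}$. -/

import Mathlib

open Filter

noncomputable section

/-- Discrete growth rate: positive, strictly increasing, unbounded, with `μ 0 = 1`. -/
structure IsGrowthRate (μ : ℕ → ℝ) : Prop where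
  pos : ∀ n, 0 < μ n
  strictMono : StrictMono μ
  tendsto_atTop : Tendsto μ atTop atTop
  zero : μ 0 = 1

/-- `stepProduct A k j = A (k + j - 1) ∘ ⋯ ∘ A k` (the identity for `j = 0`). -/
def stepProduct {𝕜 X : Type*} [RCLike 𝕜] [NormedAddCommGroup X] [NormedSpace 𝕜 X]
    (A : ℕ → X →L[𝕜] X) (k : ℕ) : ℕ → X →L[𝕜] X
  | 0 => ContinuousLinearMap.id 𝕜 X
  | j + 1 => (A (k + j)).comp (stepProduct A k j)

/-- The evolution family `Φ_A(m, k)` of `x (n + 1) = A n (x n)` with invertible `A n`: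
`A (m - 1) ∘ ⋯ ∘ A k` for `m ≥ k`, and the inverse of `Φ_A(k, m)` for `m < k`. -/
def evolution {𝕜 X : Type*} [RCLike 𝕜] [NormedAddCommGroup X] [NormedSpace 𝕜 X]
    (A : ℕ → X →L[𝕜] X) (m k : ℕ) : X →L[𝕜] X :=
  if k ≤ m then stepProduct A k (m - k) else Ring.inverse (stepProduct A m (k - m))

/-- The system `x (n + 1) = A n (x n)`, `n ≥ 1`, admits a strong nonuniform `μ`-dichotomy whose
nonuniformity exponent is `ε`. Only the indices `n ≥ 1` of `A` and `P` matter. -/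
def StrongNonuniformDichotomy {𝕜 X : Type*} [RCLike 𝕜] [NormedAddCommGroup X] [NormedSpace 𝕜 X]
    (A : ℕ → X →L[𝕜] X) (μ : ℕ → ℝ) (ε : ℝ) : Prop :=
  0 ≤ ε ∧ (∀ n, 1 ≤ n → IsUnit (A n)) ∧
  ∃ (P : ℕ → X →L[𝕜] X) (N ν ν' : ℝ), 1 ≤ N ∧ 0 < ν ∧ ν ≤ ν' ∧
    (∀ k, 1 ≤ k → (P k).comp (P k) = P k) ∧
    (∀ k, 1 ≤ k → (A k).comp (P k) = (P (k + 1)).comp (A k)) ∧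
    (∀ m k, 1 ≤ k → k ≤ m →
      ‖(evolution A m k).comp (P k)‖ ≤ N * (μ m / μ k) ^ (-ν) * μ k ^ ε ∧
      ‖(evolution A m k).comp (ContinuousLinearMap.id 𝕜 X - P k)‖
        ≤ N * (μ m / μ k) ^ ν' * μ k ^ ε) ∧
    (∀ m k, 1 ≤ m → m ≤ k →
      ‖(evolution A m k).comp (ContinuousLinearMap.id 𝕜 X - P k)‖
        ≤ N * (μ k / μ m) ^ (-ν) * μ k ^ ε ∧
      ‖(evolution A m k).comp (P k)‖ ≤ N * (μ k / μ m) ^ ν' * μ k ^ ε)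

end

/-! The dichotomy becomes uniform, with constant one, in adapted norms satisfying ‖x‖ ≤ s_n(x) ≤
2Nμ_n^ε‖x‖. The factor μ_n^{-(1+ε)} in the hypotheses compensates this distortion: measured by
s_{n+1}, the perturbation and its Lipschitz constant are of order μ_{n+1}/μ_n - 1. Forcing of this
order produces bounded solutions, the discrete analogue of ∫_1^t (t/τ)^{-ν} dτ/τ ≤ 1/ν.

Write a conjugacy as identity plus displacement. Along an orbit, the displacement solves y_{m+1} =
A_m y_m + r_m, where r_m is the difference of the two perturbations. Time is one-sided, so
boundedness leaves the stable part of y_0 free; requiring it to vanish makes the bounded solution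
unique (`IsSolution.bound_feedback`), and Picard iteration provides it
(`exists_isSolution_nonlinear`). This normalization survives composition, so conjugacies constructed
in both directions are mutually inverse by uniqueness.

For the Hölder estimate, two orbits separate at most like the power ν'+1 of the ratio of growth
rates. With ρ = ν/(2(ν'+1)), the ρ-th power of the separation grows with exponent ν/2 only, and the
solution bounds with weights tolerate that rate (`IsConjugacy.holder`). -/

/-! ### Scalar recursive inequalities along a growth rate -/

/-- The constant in the estimates of bounded solutions. -/
noncomputable def greenConst (θ ν : ℝ) : ℝ := 2 / ν * θ ^ (ν + 1)

/-- Standing assumptions on a growth rate `μ` with ratios bounded by `θ` and on the exponents. -/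
structure GrowthBounds (μ : ℕ → ℝ) (θ ν ν' : ℝ) : Prop where
  pos : ∀ n, 0 < μ n
  mono : Monotone μ
  tendsto_atTop : Tendsto μ atTop atTop
  ratio_le : ∀ n, μ (n + 1) / μ n ≤ θ
  exp_pos : 0 < ν
  exp_le : ν ≤ ν'

namespace GrowthBounds

variable {μ : ℕ → ℝ} {θ ν ν' : ℝ} (H : GrowthBounds μ θ ν ν')
include H

theorem one_le_ratio (n : ℕ) : 1 ≤ μ (n + 1) / μ n :=
  (one_le_div (H.pos n)).2 (H.mono n.le_succ)

theorem ratio_pos (n : ℕ) : 0 < μ (n + 1) / μ n := div_pos (H.pos _) (H.pos _)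

theorem one_le_bound : 1 ≤ θ := (H.one_le_ratio 0).trans (H.ratio_le 0)

theorem ratio_sub_one_nonneg (n : ℕ) : 0 ≤ μ (n + 1) / μ n - 1 :=
  sub_nonneg.2 (H.one_le_ratio n)

theorem exp'_pos : 0 < ν' := H.exp_pos.trans_le H.exp_le

theorem greenConst_pos : 0 < greenConst θ ν := by
  have := H.exp_pos
  have := H.one_le_bound
  unfold greenConst
  positivity

theorem rpow_neg_eq (n : ℕ) :
    (μ (n + 1) / μ n) ^ (-ν) =
      ((μ (n + 1) / μ n) ^ (ν / 2))⁻¹ * ((μ (n + 1) / μ n) ^ (ν / 2))⁻¹ := by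
  rw [← Real.rpow_neg (H.ratio_pos n).le, ← Real.rpow_add (H.ratio_pos n)]
  ring_nf

/-- For l = μ(n+1)/μ(n) ≤ θ one has (l - 1)/θ ≤ log l ≤ (2/ν)(l^{ν/2} - 1) and θ^{-ν} ≤ l^{-ν}. In
this form the forcing telescopes in the inductions below. -/
theorem ratio_sub_one_le (n : ℕ) :
    μ (n + 1) / μ n - 1 ≤
      greenConst θ ν * (μ (n + 1) / μ n) ^ (-ν) * ((μ (n + 1) / μ n) ^ (ν / 2) - 1) := by
  have h1 := H.one_le_ratio n
  have h2 := H.ratio_le n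
  have hν := H.exp_pos
  have hθ := H.one_le_bound
  set l := μ (n + 1) / μ n
  have hl : 0 < l := by linarith
  have hlog : (l - 1) / θ ≤ Real.log l := by
    have h3 := Real.one_sub_inv_le_log_of_pos hl
    refine le_trans ?_ h3
    have : 1 - l⁻¹ = (l - 1) / l := by field_simp
    rw [this]
    exact div_le_div_of_nonneg_left (by linarith) hl h2
  have hexp : ν / 2 * Real.log l ≤ l ^ (ν / 2) - 1 := by
    rw [Real.rpow_def_of_pos hl]
    have := Real.add_one_le_exp (Real.log l * (ν / 2))
    linarith
  have hneg : θ ^ (-ν) ≤ l ^ (-ν) := Real.rpow_le_rpow_of_nonpos hl h2 (by linarith)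
  have hK : greenConst θ ν * θ ^ (-ν) = 2 / ν * θ := by
    unfold greenConst
    rw [mul_assoc, ← Real.rpow_add (by linarith)]
    simp
  have h0 : 0 ≤ l ^ (ν / 2) - 1 := by
    have := Real.one_le_rpow h1 (by linarith : (0 : ℝ) ≤ ν / 2)
    linarith
  calc l - 1 = 2 / ν * θ * (ν / 2 * ((l - 1) / θ)) := by field_simp
    _ ≤ 2 / ν * θ * (ν / 2 * Real.log l) := by gcongr
    _ ≤ 2 / ν * θ * (l ^ (ν / 2) - 1) := by gcongr
    _ = greenConst θ ν * θ ^ (-ν) * (l ^ (ν / 2) - 1) := by rw [hK]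
    _ ≤ _ := by
      have := H.greenConst_pos
      gcongr

/-- Put β = (μ(m+1)/μ(m))^{ν/2}, so the contraction factor is β^{-2}. The forcing turns the
propagated bound Kβ^{-2}BW_m into at most Kβ^{-1}BW_m, and a weight that varies with exponent at
most ν/2 absorbs the remaining β^{-1}. -/
theorem stable_bound {a W : ℕ → ℝ} {B : ℝ} (hB : 0 ≤ B) (hW : ∀ m, 0 ≤ W m)
    (hW' : ∀ m, W m ≤ (μ (m + 1) / μ m) ^ (ν / 2) * W (m + 1)) (h0 : a 0 ≤ 0)
    (ha : ∀ m, a (m + 1) ≤ (μ (m + 1) / μ m) ^ (-ν) * a m + (μ (m + 1) / μ m - 1) * (B * W m))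
    (m : ℕ) : a m ≤ greenConst θ ν * B * W m := by
  have hK := H.greenConst_pos
  induction m with
  | zero => exact h0.trans (by have := hW 0; positivity)
  | succ m ih =>
    have h1 := H.ratio_sub_one_le m
    have h2 := H.rpow_neg_eq m
    have hb : 0 < (μ (m + 1) / μ m) ^ (ν / 2) := Real.rpow_pos_of_pos (H.ratio_pos m) _
    have hn : 0 < (μ (m + 1) / μ m) ^ (-ν) := Real.rpow_pos_of_pos (H.ratio_pos m) _
    have hBW : 0 ≤ B * W m := mul_nonneg hB (hW m)
    set K := greenConst θ ν
    have h3 : (μ (m + 1) / μ m) ^ (-ν) * (μ (m + 1) / μ m) ^ (ν / 2) * W m ≤ W (m + 1) := by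
      rw [h2]
      have : ((μ (m + 1) / μ m) ^ (ν / 2))⁻¹ * ((μ (m + 1) / μ m) ^ (ν / 2))⁻¹ *
        (μ (m + 1) / μ m) ^ (ν / 2) * W m = ((μ (m + 1) / μ m) ^ (ν / 2))⁻¹ * W m := by
        field_simp
      rw [this, inv_mul_le_iff₀ hb]
      exact hW' m
    calc a (m + 1) ≤ _ := ha m
      _ ≤ (μ (m + 1) / μ m) ^ (-ν) * (K * B * W m) +
          K * (μ (m + 1) / μ m) ^ (-ν) * ((μ (m + 1) / μ m) ^ (ν / 2) - 1) * (B * W m) := by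
        gcongr
      _ = K * B * ((μ (m + 1) / μ m) ^ (-ν) * (μ (m + 1) / μ m) ^ (ν / 2) * W m) := by ring
      _ ≤ _ := by gcongr

/-- Backward induction from n. The terminal value enters only through E, damped by a factor that
vanishes as n → ∞; keeping n finite also covers partial sums. -/
theorem unstable_bound_of_le {b W : ℕ → ℝ} {B E : ℝ} (hB : 0 ≤ B) (hW : ∀ m, 0 ≤ W m)
    (hW' : ∀ m, W (m + 1) ≤ (μ (m + 1) / μ m) ^ (ν / 2) * W m)
    (hb : ∀ m, b m ≤ (μ (m + 1) / μ m) ^ (-ν) * (b (m + 1) + (μ (m + 1) / μ m - 1) * (B * W m)))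
    {m n : ℕ} (hmn : m ≤ n) (hE : b n ≤ E) :
    b m ≤ greenConst θ ν * B * W m + (μ n / μ m) ^ (-ν) * E := by
  have hK := H.greenConst_pos
  induction hmn using Nat.decreasingInduction with
  | self =>
    have := hW n
    rw [div_self (H.pos n).ne', Real.one_rpow]
    have : 0 ≤ greenConst θ ν * B * W n := by positivity
    linarith
  | of_succ m hm ih =>
    have h1 := H.ratio_sub_one_le m
    have h2 := H.rpow_neg_eq m
    have hβ : 1 ≤ (μ (m + 1) / μ m) ^ (ν / 2) :=
      Real.one_le_rpow (H.one_le_ratio m) (by have := H.exp_pos; linarith)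
    have hn : 0 < (μ (m + 1) / μ m) ^ (-ν) := Real.rpow_pos_of_pos (H.ratio_pos m) _
    have hn1 : (μ (m + 1) / μ m) ^ (-ν) ≤ 1 :=
      Real.rpow_le_one_of_one_le_of_nonpos (H.one_le_ratio m) (by have := H.exp_pos; linarith)
    have hBW : 0 ≤ B * W m := mul_nonneg hB (hW m)
    have hmul : (μ (m + 1) / μ m) ^ (-ν) * (μ n / μ (m + 1)) ^ (-ν) = (μ n / μ m) ^ (-ν) := by
      rw [← Real.mul_rpow (H.ratio_pos m).le (div_pos (H.pos _) (H.pos _)).le]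
      congr 1
      have := (H.pos m).ne'
      have := (H.pos (m + 1)).ne'
      field_simp
    set K := greenConst θ ν
    set β := (μ (m + 1) / μ m) ^ (ν / 2)
    set γ := (μ (m + 1) / μ m) ^ (-ν)
    have h4 : γ * β * β = 1 := by rw [h2]; field_simp
    -- Since γβ² = 1, the slack is exactly Kγ(β - 1)(β - γ), and γ ≤ 1 ≤ β.
    have h5 : K * (β * γ) + γ * (K * γ * (β - 1)) ≤ K := by
      have h6 : K - (K * (β * γ) + γ * (K * γ * (β - 1))) = K * γ * (β - 1) * (β - γ) := by
        have : K = K * (γ * β * β) := by rw [h4, mul_one]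
        calc _ = K * (γ * β * β) - (K * (β * γ) + γ * (K * γ * (β - 1))) := by rw [← this]
          _ = _ := by ring
      have : 0 ≤ K * γ * (β - 1) * (β - γ) :=
        mul_nonneg (mul_nonneg (by positivity) (by linarith)) (by linarith)
      linarith
    calc b m ≤ _ := hb m
      _ ≤ γ * ((K * B * (β * W m) + (μ n / μ (m + 1)) ^ (-ν) * E) +
            (K * γ * (β - 1)) * (B * W m)) := by
        gcongr
        refine ih.trans ?_
        gcongr
        exact hW' m
      _ = (K * (β * γ) + γ * (K * γ * (β - 1))) * (B * W m) +
            γ * (μ n / μ (m + 1)) ^ (-ν) * E := by ring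
      _ ≤ K * (B * W m) + (μ n / μ m) ^ (-ν) * E := by rw [hmul]; gcongr
      _ = _ := by ring

theorem tendsto_rpow_neg (m : ℕ) : Tendsto (fun n => (μ n / μ m) ^ (-ν)) atTop (nhds 0) :=
  (tendsto_rpow_neg_atTop H.exp_pos).comp (H.tendsto_atTop.atTop_div_const (H.pos m))

theorem unstable_bound {b W : ℕ → ℝ} {B E : ℝ} (hB : 0 ≤ B) (hW : ∀ m, 0 ≤ W m)
    (hW' : ∀ m, W (m + 1) ≤ (μ (m + 1) / μ m) ^ (ν / 2) * W m)
    (hb : ∀ m, b m ≤ (μ (m + 1) / μ m) ^ (-ν) * (b (m + 1) + (μ (m + 1) / μ m - 1) * (B * W m)))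
    (hE : ∀ m, b m ≤ E) (m : ℕ) : b m ≤ greenConst θ ν * B * W m := by
  have h1 : Tendsto (fun n => greenConst θ ν * B * W m + (μ n / μ m) ^ (-ν) * E) atTop
      (nhds (greenConst θ ν * B * W m + 0 * E)) :=
    ((H.tendsto_rpow_neg m).mul_const E).const_add _
  rw [zero_mul, add_zero] at h1
  exact ge_of_tendsto h1 ((eventually_ge_atTop m).mono fun n hn =>
    H.unstable_bound_of_le hB hW hW' hb hn (hE n))

theorem le_max_ratio_rpow {d : ℕ → ℝ} {a : ℝ} (n : ℕ)
    (h1 : ∀ m, d (m + 1) ≤ (μ (m + 1) / μ m) ^ a * d m)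
    (h2 : ∀ m, d m ≤ (μ (m + 1) / μ m) ^ a * d (m + 1)) (ha : 0 ≤ a) (hd : 0 ≤ d n) (m : ℕ) :
    d m ≤ (max (μ m / μ n) (μ n / μ m)) ^ a * d n := by
  have hmul : ∀ i j k, (μ i / μ j) ^ a * (μ j / μ k) ^ a = (μ i / μ k) ^ a := by
    intro i j k
    rw [← Real.mul_rpow (div_pos (H.pos _) (H.pos _)).le (div_pos (H.pos _) (H.pos _)).le]
    congr 1
    have := (H.pos j).ne'
    have := (H.pos k).ne'
    field_simp
  have hp : ∀ i j, 0 < μ i / μ j := fun i j => div_pos (H.pos _) (H.pos _)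
  rcases le_total n m with h | h
  · have key : d m ≤ (μ m / μ n) ^ a * d n := by
      induction m, h using Nat.le_induction with
      | base => simp [div_self (H.pos n).ne']
      | succ m hm ih =>
        refine (h1 m).trans ?_
        rw [← hmul (m + 1) m n, mul_assoc]
        exact mul_le_mul_of_nonneg_left ih (Real.rpow_pos_of_pos (hp _ _) _).le
    refine key.trans ?_
    have := hp m n
    gcongr
    exact le_max_left _ _
  · have key : d m ≤ (μ n / μ m) ^ a * d n := by
      induction h using Nat.decreasingInduction with
      | self => simp [div_self (H.pos n).ne']
      | of_succ m hm ih =>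
        refine (h2 m).trans ?_
        rw [← hmul n (m + 1) m, mul_comm ((μ n / μ (m + 1)) ^ a), mul_assoc]
        exact mul_le_mul_of_nonneg_left ih (Real.rpow_pos_of_pos (hp _ _) _).le
    refine key.trans ?_
    have := hp n m
    gcongr
    exact le_max_right _ _

theorem one_le_max_ratio (m n : ℕ) : 1 ≤ max (μ m / μ n) (μ n / μ m) := by
  rcases le_total n m with h | h
  · exact le_max_of_le_left ((one_le_div (H.pos _)).2 (H.mono h))
  · exact le_max_of_le_right ((one_le_div (H.pos _)).2 (H.mono h))

theorem max_ratio_succ_le (m n : ℕ) : max (μ (m + 1) / μ n) (μ n / μ (m + 1)) ≤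
    μ (m + 1) / μ m * max (μ m / μ n) (μ n / μ m) := by
  have h0 := H.pos m
  have h1 := H.pos n
  have h2 := H.pos (m + 1)
  have h3 := H.one_le_ratio m
  refine max_le ?_ ?_
  · calc μ (m + 1) / μ n = μ (m + 1) / μ m * (μ m / μ n) := by field_simp
      _ ≤ _ := by gcongr; exact le_max_left _ _
  · calc μ n / μ (m + 1) ≤ 1 * (μ n / μ m) := by
          rw [one_mul]; gcongr; exact H.mono m.le_succ
      _ ≤ _ := by gcongr; exact le_max_right _ _

theorem max_ratio_le_succ (m n : ℕ) : max (μ m / μ n) (μ n / μ m) ≤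
    μ (m + 1) / μ m * max (μ (m + 1) / μ n) (μ n / μ (m + 1)) := by
  have h0 := H.pos m
  have h1 := H.pos n
  have h2 := H.pos (m + 1)
  have h3 := H.one_le_ratio m
  refine max_le ?_ ?_
  · calc μ m / μ n ≤ 1 * (μ (m + 1) / μ n) := by
          rw [one_mul]; gcongr; exact H.mono m.le_succ
      _ ≤ _ := by gcongr; exact le_max_left _ _
  · calc μ n / μ m = μ (m + 1) / μ m * (μ n / μ (m + 1)) := by field_simp
      _ ≤ _ := by gcongr; exact le_max_right _ _

end GrowthBounds

/-! ### Adapted norms and a priori bounds for bounded solutions -/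

/-- Families of seminorms adapted to the stable and unstable directions of `A`, in which the
dichotomy is uniform and holds with constant one. -/
structure AdaptedNorms {𝕜 X : Type*} [RCLike 𝕜] [NormedAddCommGroup X] [NormedSpace 𝕜 X]
    (A : ℕ → X ≃L[𝕜] X) (μ : ℕ → ℝ) (ν ν' : ℝ) (C : ℕ → ℝ) where
  /-- the seminorms of the stable directions -/
  p : ℕ → AddGroupSeminorm X
  /-- the seminorms of the unstable directions -/
  q : ℕ → AddGroupSeminorm X
  norm_le : ∀ n x, ‖x‖ ≤ p n x + q n x
  p_le : ∀ n x, p n x ≤ C n * ‖x‖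
  q_le : ∀ n x, q n x ≤ C n * ‖x‖
  p_step : ∀ n x, p (n + 1) (A n x) ≤ (μ (n + 1) / μ n) ^ (-ν) * p n x
  p_back : ∀ n x, p n x ≤ (μ (n + 1) / μ n) ^ ν' * p (n + 1) (A n x)
  q_step : ∀ n x, q n x ≤ (μ (n + 1) / μ n) ^ (-ν) * q (n + 1) (A n x)
  q_grow : ∀ n x, q (n + 1) (A n x) ≤ (μ (n + 1) / μ n) ^ ν' * q n x
  split : ∀ n x, ∃ a, p n (x - a) = 0 ∧ q n a = 0

/-- The linear flow from time `0` to time `n`. -/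
def linearFlow {𝕜 X : Type*} [RCLike 𝕜] [NormedAddCommGroup X] [NormedSpace 𝕜 X]
    (A : ℕ → X ≃L[𝕜] X) : ℕ → X ≃L[𝕜] X
  | 0 => ContinuousLinearEquiv.refl 𝕜 X
  | n + 1 => (linearFlow A n).trans (A n)

namespace AdaptedNorms

variable {𝕜 X : Type*} [RCLike 𝕜] [NormedAddCommGroup X] [NormedSpace 𝕜 X]
  {A : ℕ → X ≃L[𝕜] X} {μ : ℕ → ℝ} {θ ν ν' : ℝ} {C : ℕ → ℝ}
  (L : AdaptedNorms A μ ν ν' C)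

/-- The adapted norm `p n + q n`. -/
def s (n : ℕ) : AddGroupSeminorm X := L.p n + L.q n

theorem s_apply (n : ℕ) (x : X) : L.s n x = L.p n x + L.q n x := rfl

theorem norm_le_s (n : ℕ) (x : X) : ‖x‖ ≤ L.s n x := L.norm_le n x

theorem p_le_s (n : ℕ) (x : X) : L.p n x ≤ L.s n x :=
  le_add_of_nonneg_right (apply_nonneg (L.q n) x)

theorem q_le_s (n : ℕ) (x : X) : L.q n x ≤ L.s n x :=
  le_add_of_nonneg_left (apply_nonneg (L.p n) x)

theorem s_le (n : ℕ) (x : X) : L.s n x ≤ 2 * C n * ‖x‖ := by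
  have := L.p_le n x
  have := L.q_le n x
  rw [s_apply]
  linarith

theorem continuous_of_le {f : AddGroupSeminorm X} {K : ℝ} (h : ∀ x, f x ≤ K * ‖x‖) :
    Continuous f := by
  refine (LipschitzWith.of_le_add_mul K.toNNReal fun x y => ?_).continuous
  have h1 : f x ≤ f y + f (x - y) := by simpa using map_add_le_add f y (x - y)
  refine h1.trans ?_
  gcongr
  rw [dist_eq_norm]
  exact (h _).trans (mul_le_mul_of_nonneg_right (Real.le_coe_toNNReal K) (norm_nonneg _))

theorem continuous_p (n : ℕ) : Continuous (L.p n) := continuous_of_le (L.p_le n)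

theorem continuous_q (n : ℕ) : Continuous (L.q n) := continuous_of_le (L.q_le n)

theorem continuous_s (n : ℕ) : Continuous (L.s n) := continuous_of_le (L.s_le n)

/-- `y` is a solution of `y (m + 1) = A m (y m) + r m`, bounded in the adapted norms, whose
initial value has no stable component. -/
structure IsSolution (r y : ℕ → X) : Prop where
  step : ∀ m, y (m + 1) = A m (y m) + r m
  init : L.p 0 (y 0) = 0
  bdd : ∃ E, ∀ m, L.s m (y m) ≤ E

variable {L}

theorem IsSolution.sub {r r' y y' : ℕ → X} (h : L.IsSolution r y) (h' : L.IsSolution r' y') :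
    L.IsSolution (fun m => r m - r' m) (fun m => y m - y' m) where
  step m := by rw [h.step, h'.step, map_sub]; abel
  init := by
    have := map_sub_le_add (L.p 0) (y 0) (y' 0)
    rw [h.init, h'.init, add_zero] at this
    exact le_antisymm this (apply_nonneg _ _)
  bdd := by
    obtain ⟨E, hE⟩ := h.bdd
    obtain ⟨E', hE'⟩ := h'.bdd
    exact ⟨E + E', fun m => (map_sub_le_add _ _ _).trans (add_le_add (hE m) (hE' m))⟩

theorem p_succ_le {r y : ℕ → X} {m : ℕ} {b : ℝ}
    (hy : y (m + 1) = A m (y m) + r m) (hr : L.p (m + 1) (r m) ≤ b) :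
    L.p (m + 1) (y (m + 1)) ≤ (μ (m + 1) / μ m) ^ (-ν) * L.p m (y m) + b := by
  rw [hy]
  exact (map_add_le_add _ _ _).trans (add_le_add (L.p_step m _) hr)

theorem q_le_succ (H : GrowthBounds μ θ ν ν') {r y : ℕ → X} {m : ℕ} {b : ℝ}
    (hy : y (m + 1) = A m (y m) + r m) (hr : L.q (m + 1) (r m) ≤ b) :
    L.q m (y m) ≤ (μ (m + 1) / μ m) ^ (-ν) * (L.q (m + 1) (y (m + 1)) + b) := by
  have h1 : A m (y m) = y (m + 1) - r m := by rw [hy]; abel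
  refine (L.q_step m _).trans ?_
  have := H.ratio_pos m
  rw [h1]
  gcongr
  exact (map_sub_le_add _ _ _).trans (add_le_add le_rfl hr)

/-- The stable part is controlled forward from its zero initial value, the unstable part backward
from boundedness at infinity; the two contributions give the factor 2. -/
theorem IsSolution.bound (H : GrowthBounds μ θ ν ν') {r y : ℕ → X}
    (h : L.IsSolution r y) {B : ℝ} {W : ℕ → ℝ} (hB : 0 ≤ B) (hW : ∀ m, 0 ≤ W m)
    (hW₁ : ∀ m, W m ≤ (μ (m + 1) / μ m) ^ (ν / 2) * W (m + 1))
    (hW₂ : ∀ m, W (m + 1) ≤ (μ (m + 1) / μ m) ^ (ν / 2) * W m)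
    (hr : ∀ m, L.s (m + 1) (r m) ≤ (μ (m + 1) / μ m - 1) * (B * W m)) (m : ℕ) :
    L.s m (y m) ≤ 2 * greenConst θ ν * B * W m := by
  obtain ⟨E, hE⟩ := h.bdd
  have h1 := H.stable_bound (a := fun m => L.p m (y m)) hB hW hW₁ h.init.le
    (fun m => p_succ_le (h.step m) ((L.p_le_s _ _).trans (hr m))) m
  have h2 := H.unstable_bound (b := fun m => L.q m (y m)) hB hW hW₂
    (fun m => q_le_succ H (h.step m) ((L.q_le_s _ _).trans (hr m)))
    (fun m => (L.q_le_s _ _).trans (hE m)) m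
  rw [s_apply]
  linarith

theorem IsSolution.bound_const (H : GrowthBounds μ θ ν ν') {r y : ℕ → X}
    (h : L.IsSolution r y) {B : ℝ} (hB : 0 ≤ B)
    (hr : ∀ m, L.s (m + 1) (r m) ≤ (μ (m + 1) / μ m - 1) * B) (m : ℕ) :
    L.s m (y m) ≤ 2 * greenConst θ ν * B := by
  have hβ : ∀ m, 1 ≤ (μ (m + 1) / μ m) ^ (ν / 2) * 1 := fun m => by
    rw [mul_one]
    exact Real.one_le_rpow (H.one_le_ratio m) (by have := H.exp_pos; linarith)
  simpa using h.bound H (W := fun _ => 1) hB (fun _ => zero_le_one) hβ hβ (by simpa using hr) m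

/-- Absorption: R = sup s_m(y_m)/W_m is finite because y is bounded and W ≥ 1, and the linear bound
gives R ≤ 2K(B + cR) with 2Kc ≤ 1/2. -/
theorem IsSolution.bound_feedback (H : GrowthBounds μ θ ν ν') {r y : ℕ → X}
    (h : L.IsSolution r y) {B c : ℝ} {W : ℕ → ℝ} (hB : 0 ≤ B) (hc : 0 ≤ c)
    (hcK : 4 * greenConst θ ν * c ≤ 1) (hW : ∀ m, 1 ≤ W m)
    (hW₁ : ∀ m, W m ≤ (μ (m + 1) / μ m) ^ (ν / 2) * W (m + 1))
    (hW₂ : ∀ m, W (m + 1) ≤ (μ (m + 1) / μ m) ^ (ν / 2) * W m)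
    (hr : ∀ m, L.s (m + 1) (r m) ≤ (μ (m + 1) / μ m - 1) * (B * W m + c * L.s m (y m))) (m : ℕ) :
    L.s m (y m) ≤ 4 * greenConst θ ν * B * W m := by
  have hK := H.greenConst_pos
  obtain ⟨E, hE⟩ := h.bdd
  have hWp : ∀ m, 0 < W m := fun m => one_pos.trans_le (hW m)
  have hbd : BddAbove (Set.range fun m => L.s m (y m) / W m) := by
    refine ⟨E, ?_⟩
    rintro _ ⟨m, rfl⟩
    exact (div_le_self (apply_nonneg _ _) (hW m)).trans (hE m)
  set R := ⨆ m, L.s m (y m) / W m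
  have hR : ∀ m, L.s m (y m) ≤ R * W m := fun m => (div_le_iff₀ (hWp m)).1 (le_ciSup hbd m)
  have hR0 : 0 ≤ R := Real.iSup_nonneg fun m => div_nonneg (apply_nonneg _ _) (hWp m).le
  have h1 := h.bound H (B := B + c * R) (by positivity) (fun m => (hWp m).le) hW₁ hW₂ fun m => by
    refine (hr m).trans (mul_le_mul_of_nonneg_left ?_ (H.ratio_sub_one_nonneg m))
    rw [add_mul, mul_assoc]
    gcongr
    exact hR m
  have h2 : R ≤ 2 * greenConst θ ν * (B + c * R) :=
    ciSup_le fun m => (div_le_iff₀ (hWp m)).2 (h1 m)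
  have h3 : R ≤ 4 * greenConst θ ν * B := by nlinarith
  exact (hR m).trans (mul_le_mul_of_nonneg_right h3 (hWp m).le)

theorem IsSolution.bound_feedback_const (H : GrowthBounds μ θ ν ν') {r y : ℕ → X}
    (h : L.IsSolution r y) {B c : ℝ} (hB : 0 ≤ B) (hc : 0 ≤ c)
    (hcK : 4 * greenConst θ ν * c ≤ 1)
    (hr : ∀ m, L.s (m + 1) (r m) ≤ (μ (m + 1) / μ m - 1) * (B + c * L.s m (y m))) (m : ℕ) :
    L.s m (y m) ≤ 4 * greenConst θ ν * B := by
  have hβ : ∀ m, 1 ≤ (μ (m + 1) / μ m) ^ (ν / 2) * 1 := fun m => by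
    rw [mul_one]
    exact Real.one_le_rpow (H.one_le_ratio m) (by have := H.exp_pos; linarith)
  simpa using h.bound_feedback H (W := fun _ => 1) hB hc hcK (fun _ => le_rfl) hβ hβ
    (by simpa using hr) m

theorem p_linearFlow_eq_zero {z : X} (hz : L.p 0 z = 0) (n : ℕ) :
    L.p n (linearFlow A n z) = 0 := by
  induction n with
  | zero => exact hz
  | succ n ih =>
    have := L.p_step n (linearFlow A n z)
    rw [ih, mul_zero] at this
    exact le_antisymm this (apply_nonneg _ _)

theorem p_linearFlow_symm_eq_zero {n : ℕ} {x : X} (hx : L.p n x = 0) :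
    L.p 0 ((linearFlow A n).symm x) = 0 := by
  induction n generalizing x with
  | zero => exact hx
  | succ n ih =>
    refine ih (x := (A n).symm x) ?_
    have := L.p_back n ((A n).symm x)
    rw [ContinuousLinearEquiv.apply_symm_apply, hx, mul_zero] at this
    exact le_antisymm this (apply_nonneg _ _)

/-! ### Existence of bounded solutions -/

/-- With U the linear flow, the solution is y_m = -∑_{k≥m} U_m U_{k+1}^{-1} b_k, written as U_m(S_m
- z) with z = lim S_n. Replacing z by S_n gives a solution vanishing at time n, to which the
backward bound applies with E = 0. -/
theorem exists_isSolution_unstable [CompleteSpace X] (H : GrowthBounds μ θ ν ν') {b : ℕ → X}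
    {B : ℝ} (hB : 0 ≤ B) (hp : ∀ m, L.p (m + 1) (b m) = 0)
    (hq : ∀ m, L.q (m + 1) (b m) ≤ (μ (m + 1) / μ m - 1) * B) : ∃ y, L.IsSolution b y := by
  set U := linearFlow A
  set S : ℕ → X := fun n => ∑ k ∈ Finset.range n, (U (k + 1)).symm (b k) with hS
  have hstep : ∀ (z : X) m, U (m + 1) (S (m + 1) - z) = A m (U m (S m - z)) + b m := by
    intro z m
    have h1 : S (m + 1) - z = (S m - z) + (U (m + 1)).symm (b m) := by
      simp only [hS, Finset.sum_range_succ]; abel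
    rw [h1, map_add, ContinuousLinearEquiv.apply_symm_apply]
    rfl
  have hpS : ∀ n, L.p 0 (S n) = 0 := by
    intro n
    induction n with
    | zero => simp [hS]
    | succ n ih =>
      have h1 : S (n + 1) = S n + (U (n + 1)).symm (b n) := by
        simp only [hS, Finset.sum_range_succ]
      have h2 := map_add_le_add (L.p 0) (S n) ((U (n + 1)).symm (b n))
      rw [ih, p_linearFlow_symm_eq_zero (hp n), add_zero, ← h1] at h2
      exact le_antisymm h2 (apply_nonneg _ _)
  have hpsub : ∀ m z, L.p 0 z = 0 → L.p 0 (S m - z) = 0 := by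
    intro m z hz
    have h2 := map_sub_le_add (L.p 0) (S m) z
    rw [hpS, hz, add_zero] at h2
    exact le_antisymm h2 (apply_nonneg _ _)
  have hβ : ∀ m, (1 : ℝ) ≤ (μ (m + 1) / μ m) ^ (ν / 2) * 1 := fun m => by
    rw [mul_one]
    exact Real.one_le_rpow (H.one_le_ratio m) (by have := H.exp_pos; linarith)
  have hqS : ∀ m n, m ≤ n → L.q m (U m (S m - S n)) ≤ greenConst θ ν * B := by
    intro m n hmn
    have h1 := H.unstable_bound_of_le (b := fun m => L.q m (U m (S m - S n))) (W := fun _ => 1)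
      (E := 0) hB (fun _ => zero_le_one) hβ
      (fun m => q_le_succ H (y := fun m => U m (S m - S n)) (hstep (S n) m) (by simpa using hq m))
      hmn (by simp)
    simpa using h1
  -- The bound for S_m - S_n at time m is carried back to time 0 by the homogeneous equation, which
  -- gains the factor (μ_m/μ_0)^{-ν}.
  have hcauchy : CauchySeq S := by
    have h0 : Tendsto (fun m => (μ m / μ 0) ^ (-ν) * (greenConst θ ν * B)) atTop (nhds 0) := by
      simpa using (H.tendsto_rpow_neg 0).mul_const (greenConst θ ν * B)
    have hle : ∀ m n, m ≤ n → dist (S m) (S n) ≤ (μ m / μ 0) ^ (-ν) * (greenConst θ ν * B) := by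
      intro m n hmn
      rw [dist_eq_norm]
      refine (L.norm_le 0 _).trans ?_
      rw [hpsub m _ (hpS n), zero_add]
      have h1 := H.unstable_bound_of_le (b := fun m' => L.q m' (U m' (S m - S n)))
        (W := fun _ => 1) (B := 0) le_rfl (fun _ => zero_le_one) hβ
        (fun m' => q_le_succ H (y := fun m' => U m' (S m - S n)) (r := fun _ => 0)
          (by rw [add_zero]; rfl) (by simp)) (Nat.zero_le m) (hqS m n hmn)
      rwa [mul_zero, zero_mul, zero_add] at h1
    refine Metric.cauchySeq_iff'.2 fun δ hδ => ?_
    obtain ⟨N, hN⟩ := (h0.eventually (gt_mem_nhds hδ)).exists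
    refine ⟨N, fun n hn => ?_⟩
    rw [dist_comm]
    exact (hle N n hn).trans_lt hN
  obtain ⟨z, hz⟩ := cauchySeq_tendsto_of_complete hcauchy
  have hpz : L.p 0 z = 0 := by
    have h1 := ((L.continuous_p 0).tendsto z).comp hz
    refine tendsto_nhds_unique h1 ?_
    simp only [Function.comp_def, hpS]
    exact tendsto_const_nhds
  refine ⟨fun m => U m (S m - z), hstep z, p_linearFlow_eq_zero (hpsub 0 z hpz) 0,
    greenConst θ ν * B, fun m => ?_⟩
  rw [s_apply, p_linearFlow_eq_zero (hpsub m z hpz) m, zero_add]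
  have h1 : Tendsto (fun n => L.q m (U m (S m - S n))) atTop (nhds (L.q m (U m (S m - z)))) :=
    (((L.continuous_q m).comp (U m).continuous).tendsto _).comp (hz.const_sub (S m))
  exact le_of_tendsto h1 ((eventually_ge_atTop m).mono fun n hn => hqS m n hn)

theorem exists_isSolution_stable (H : GrowthBounds μ θ ν ν') {a : ℕ → X}
    {B : ℝ} (hB : 0 ≤ B) (hq : ∀ m, L.q (m + 1) (a m) = 0)
    (hp : ∀ m, L.p (m + 1) (a m) ≤ (μ (m + 1) / μ m - 1) * B) : ∃ y, L.IsSolution a y := by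
  set u : ℕ → X := fun n => Nat.rec 0 (fun m x => A m x + a m) n
  have hu : ∀ m, u (m + 1) = A m (u m) + a m := fun m => rfl
  have hqu : ∀ m, L.q m (u m) = 0 := by
    intro m
    induction m with
    | zero => exact map_zero (L.q 0)
    | succ m ih =>
      have h1 := L.q_grow m (u m)
      rw [ih, mul_zero] at h1
      have h2 := map_add_le_add (L.q (m + 1)) (A m (u m)) (a m)
      rw [hq, add_zero, ← hu] at h2
      exact le_antisymm (h2.trans h1) (apply_nonneg _ _)
  have hβ : ∀ m, (1 : ℝ) ≤ (μ (m + 1) / μ m) ^ (ν / 2) * 1 := fun m => by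
    rw [mul_one]
    exact Real.one_le_rpow (H.one_le_ratio m) (by have := H.exp_pos; linarith)
  have h0 : L.p 0 (u 0) = 0 := map_zero (L.p 0)
  refine ⟨u, hu, h0, greenConst θ ν * B, fun m => ?_⟩
  rw [s_apply, hqu, add_zero]
  simpa using H.stable_bound (a := fun m => L.p m (u m)) (W := fun _ => 1) hB
    (fun _ => zero_le_one) hβ h0.le (fun m => p_succ_le (hu m) (by simpa using hp m)) m

theorem exists_isSolution [CompleteSpace X] (H : GrowthBounds μ θ ν ν') {r : ℕ → X}
    {B : ℝ} (hB : 0 ≤ B) (hr : ∀ m, L.s (m + 1) (r m) ≤ (μ (m + 1) / μ m - 1) * B) :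
    ∃ y, L.IsSolution r y := by
  choose a ha using fun m => L.split (m + 1) (r m)
  obtain ⟨u, hu⟩ := exists_isSolution_stable (L := L) H (a := a) hB (fun m => (ha m).2) fun m => by
    have h1 : L.p (m + 1) (a m) ≤ L.p (m + 1) (r m) + L.p (m + 1) (r m - a m) := by
      simpa using map_sub_le_add (L.p (m + 1)) (r m) (r m - a m)
    rw [(ha m).1, add_zero] at h1
    exact h1.trans ((L.p_le_s _ _).trans (hr m))
  -- The sign is chosen so that `IsSolution.sub` adds up the two parts of r.
  obtain ⟨v, hv⟩ := exists_isSolution_unstable (L := L) H (b := fun m => -(r m - a m)) hB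
    (fun m => by rw [map_neg_eq_map, (ha m).1]) fun m => by
      have h1 := map_sub_le_add (L.q (m + 1)) (r m) (a m)
      rw [(ha m).2, add_zero] at h1
      rw [map_neg_eq_map]
      exact h1.trans ((L.q_le_s _ _).trans (hr m))
  have h := hu.sub hv
  simp only [sub_neg_eq_add, add_sub_cancel] at h
  exact ⟨_, h⟩

/-- Picard iteration: T y is the bounded solution forced by r(y). The linear bound makes T contract
the supremum of the adapted norms by 2Kc ≤ 1/2, and ‖·‖ ≤ s_m gives convergence at each time. -/
theorem exists_isSolution_nonlinear [CompleteSpace X] (H : GrowthBounds μ θ ν ν')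
    {r : ℕ → X → X} {B c : ℝ} (hB : 0 ≤ B) (hc : 0 ≤ c) (hcK : 4 * greenConst θ ν * c ≤ 1)
    (hr : ∀ m x, L.s (m + 1) (r m x) ≤ (μ (m + 1) / μ m - 1) * B)
    (hr' : ∀ m x y, L.s (m + 1) (r m x - r m y) ≤ (μ (m + 1) / μ m - 1) * (c * L.s m (x - y))) :
    ∃ y, L.IsSolution (fun m => r m (y m)) y := by
  have hK := H.greenConst_pos
  choose T hT using fun y : ℕ → X =>
    exists_isSolution (L := L) H (r := fun m => r m (y m)) hB fun m => hr m (y m)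
  set D := 2 * greenConst θ ν * B
  have hbd : ∀ y m, L.s m (T y m) ≤ D := fun y m => (hT y).bound_const H hB (fun m => hr m _) m
  set y : ℕ → ℕ → X := fun i => T^[i] 0
  have hy : ∀ i, y (i + 1) = T (y i) := fun i => Function.iterate_succ_apply' T i 0
  have hdiff : ∀ i m, L.s m (y (i + 1) m - y i m) ≤ D * (1 / 2) ^ i := by
    intro i
    induction i with
    | zero =>
      intro m
      rw [hy]
      simpa [y] using hbd 0 m
    | succ i ih =>
      intro m
      have hD : 0 ≤ D * (1 / 2) ^ i := by positivity
      have h1 : L.s m (y (i + 1 + 1) m - y (i + 1) m) ≤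
          2 * greenConst θ ν * (c * (D * (1 / 2) ^ i)) := by
        rw [hy (i + 1), hy i]
        refine ((hT (T (y i))).sub (hT (y i))).bound_const H (B := c * (D * (1 / 2) ^ i))
          (by positivity) (fun m => (hr' m _ _).trans ?_) m
        rw [← hy i]
        have := H.ratio_sub_one_nonneg m
        gcongr
        exact ih m
      refine h1.trans ?_
      rw [pow_succ]
      nlinarith
  have hlim : ∀ m, ∃ z, Tendsto (fun i => y i m) atTop (nhds z) := by
    intro m
    refine cauchySeq_tendsto_of_complete (cauchySeq_of_le_geometric (1 / 2) D (by norm_num) ?_)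
    intro i
    rw [dist_comm, dist_eq_norm]
    exact (L.norm_le_s m _).trans (hdiff i m)
  choose z hz using hlim
  have hz1 : ∀ m, Tendsto (fun i => y (i + 1) m) atTop (nhds (z m)) :=
    fun m => (tendsto_add_atTop_iff_nat 1).2 (hz m)
  refine ⟨z, fun m => ?_, ?_, D, fun m => ?_⟩
  · have hrt : Tendsto (fun i => r m (y i m)) atTop (nhds (r m (z m))) := by
      rw [tendsto_iff_norm_sub_tendsto_zero]
      have h1 : Tendsto (fun i => (μ (m + 1) / μ m - 1) * (c * L.s m (y i m - z m))) atTop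
          (nhds ((μ (m + 1) / μ m - 1) * (c * L.s m (z m - z m)))) :=
        ((((L.continuous_s m).tendsto _).comp ((hz m).sub_const (z m))).const_mul c).const_mul _
      rw [sub_self, map_zero, mul_zero, mul_zero] at h1
      exact squeeze_zero (fun _ => norm_nonneg _)
        (fun i => (L.norm_le_s (m + 1) _).trans (hr' m _ _)) h1
    refine tendsto_nhds_unique (hz1 (m + 1)) ?_
    have h2 : Tendsto (fun i => A m (y (i + 1) m) + r m (y i m)) atTop
        (nhds (A m (z m) + r m (z m))) :=
      (((A m).continuous.tendsto _).comp (hz1 m)).add hrt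
    refine h2.congr fun i => ?_
    rw [hy]
    exact ((hT (y i)).step m).symm
  · refine tendsto_nhds_unique (((L.continuous_p 0).tendsto _).comp (hz1 0)) ?_
    refine tendsto_const_nhds.congr fun i => ?_
    rw [Function.comp_apply, hy]
    exact (hT (y i)).init.symm
  · refine le_of_tendsto (((L.continuous_s m).tendsto _).comp (hz1 m)) ?_
    refine Eventually.of_forall fun i => ?_
    rw [Function.comp_apply, hy]
    exact hbd _ m

end AdaptedNorms

/-! ### Perturbed systems and their orbits -/

/-- The composition `F (n - 1) ∘ ⋯ ∘ F 0`. -/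
def iteratedFlow {X : Type*} (F : ℕ → X ≃ X) : ℕ → X ≃ X
  | 0 => Equiv.refl X
  | n + 1 => (iteratedFlow F n).trans (F n)

/-- The orbit of `x (m + 1) = F m (x m)` passing through `x` at time `n`. -/
def orbitThrough {X : Type*} (F : ℕ → X ≃ X) (n : ℕ) (x : X) (m : ℕ) : X :=
  iteratedFlow F m ((iteratedFlow F n).symm x)

theorem orbitThrough_self {X : Type*} (F : ℕ → X ≃ X) (n : ℕ) (x : X) :
    orbitThrough F n x n = x :=
  (iteratedFlow F n).apply_symm_apply x

theorem orbitThrough_succ {X : Type*} (F : ℕ → X ≃ X) (n : ℕ) (x : X) (m : ℕ) :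
    orbitThrough F n x (m + 1) = F m (orbitThrough F n x m) := rfl

theorem iteratedFlow_succ_symm {X : Type*} (F : ℕ → X ≃ X) (n : ℕ) (x : X) :
    (iteratedFlow F (n + 1)).symm (F n x) = (iteratedFlow F n).symm x := by
  rw [Equiv.symm_apply_eq]
  change F n x = F n (iteratedFlow F n ((iteratedFlow F n).symm x))
  rw [Equiv.apply_symm_apply]

/-- Admissible sizes of a perturbation and of its Lipschitz constant. -/
structure SmallPerturbation (θ ν ν' M c : ℝ) : Prop where
  bound_nonneg : 0 ≤ M
  lip_nonneg : 0 ≤ c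
  lip_le : 4 * greenConst θ ν * c ≤ 1
  lip_le' : c ≤ θ ^ (-(ν' + 1))

namespace AdaptedNorms

variable {𝕜 X : Type*} [RCLike 𝕜] [NormedAddCommGroup X] [NormedSpace 𝕜 X]
  {A : ℕ → X ≃L[𝕜] X} {μ : ℕ → ℝ} {θ ν ν' : ℝ} {C : ℕ → ℝ}
  (L : AdaptedNorms A μ ν ν' C)

/-- Bounded and Lipschitz perturbations, measured in the adapted norms. -/
structure IsPerturbation (M c : ℝ) (g : ℕ → X → X) : Prop where
  bound : ∀ n x, L.s (n + 1) (g n x) ≤ (μ (n + 1) / μ n - 1) * M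
  lip : ∀ n x y, L.s (n + 1) (g n x - g n y) ≤ (μ (n + 1) / μ n - 1) * (c * ‖x - y‖)

variable {L}

theorem s_grow (H : GrowthBounds μ θ ν ν') (n : ℕ) (x : X) :
    L.s (n + 1) (A n x) ≤ (μ (n + 1) / μ n) ^ ν' * L.s n x := by
  rw [s_apply, s_apply, mul_add]
  refine add_le_add ((L.p_step n x).trans ?_) (L.q_grow n x)
  have h1 := H.one_le_ratio n
  have h2 := H.exp_pos
  have h3 := H.exp_le
  gcongr
  linarith

theorem s_back (H : GrowthBounds μ θ ν ν') (n : ℕ) (x : X) :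
    L.s n x ≤ (μ (n + 1) / μ n) ^ ν' * L.s (n + 1) (A n x) := by
  rw [s_apply, s_apply, mul_add]
  refine add_le_add (L.p_back n x) ((L.q_step n x).trans ?_)
  have h1 := H.one_le_ratio n
  have h2 := H.exp_pos
  have h3 := H.exp_le
  gcongr
  linarith

/-- The left side bounds the Lipschitz constant of A_n^{-1}g_n. Being at most 1 - 1/l, it makes A_n
+ g_n invertible, at the cost of one extra power of l: l^{ν'}/(1 - (1 - 1/l)) = l^{ν'+1}. -/
theorem lip_mul_le (H : GrowthBounds μ θ ν ν') {M c : ℝ}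
    (hc : SmallPerturbation θ ν ν' M c) (n : ℕ) :
    (μ (n + 1) / μ n) ^ ν' * ((μ (n + 1) / μ n - 1) * c) ≤ 1 - (μ (n + 1) / μ n)⁻¹ := by
  have h1 := H.one_le_ratio n
  have h2 := H.ratio_le n
  have h3 := H.exp'_pos
  set l := μ (n + 1) / μ n
  have hl : 0 < l := by linarith
  have h4 : c ≤ l ^ (-(ν' + 1)) :=
    hc.lip_le'.trans (Real.rpow_le_rpow_of_nonpos hl h2 (by linarith))
  have h5 : l ^ ν' * l ^ (-(ν' + 1)) = l⁻¹ := by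
    rw [← Real.rpow_add hl, ← Real.rpow_neg_one]
    congr 1
    ring
  calc l ^ ν' * ((l - 1) * c) ≤ l ^ ν' * ((l - 1) * l ^ (-(ν' + 1))) := by
        have : 0 ≤ l - 1 := by linarith
        gcongr
    _ = (l - 1) * (l ^ ν' * l ^ (-(ν' + 1))) := by ring
    _ = _ := by rw [h5]; field_simp

section

variable {f g : ℕ → X → X} {M c : ℝ} {F G : ℕ → X ≃ X}

theorem isPerturbation_zero (H : GrowthBounds μ θ ν ν') (hM : 0 ≤ M) (hc : 0 ≤ c) :
    L.IsPerturbation M c (fun _ _ => 0) where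
  bound n x := by
    have := H.ratio_sub_one_nonneg n
    rw [map_zero]
    positivity
  lip n x y := by
    have := H.ratio_sub_one_nonneg n
    rw [sub_self, map_zero]
    positivity

theorem IsPerturbation.succ_le (H : GrowthBounds μ θ ν ν') (hc : SmallPerturbation θ ν ν' M c)
    (hg : L.IsPerturbation M c g) (n : ℕ) (x y : X) :
    L.s (n + 1) (A n x + g n x - (A n y + g n y)) ≤
      (μ (n + 1) / μ n) ^ (ν' + 1) * L.s n (x - y) := by
  have h1 := H.one_le_ratio n
  have h0 := H.ratio_sub_one_nonneg n
  have hs : 0 ≤ L.s n (x - y) := apply_nonneg _ _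
  have hν' := H.exp'_pos
  have hc1 : c ≤ 1 := hc.lip_le'.trans
    (Real.rpow_le_one_of_one_le_of_nonpos H.one_le_bound (by linarith))
  have h2 : A n x + g n x - (A n y + g n y) = A n (x - y) + (g n x - g n y) := by
    rw [map_sub]; abel
  have h3 : 1 ≤ (μ (n + 1) / μ n) ^ ν' := Real.one_le_rpow h1 hν'.le
  have hn := L.norm_le_s n (x - y)
  have hc0 := hc.lip_nonneg
  rw [h2, Real.rpow_add_one (H.ratio_pos n).ne']
  calc _ ≤ (μ (n + 1) / μ n) ^ ν' * L.s n (x - y) +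
        (μ (n + 1) / μ n - 1) * (1 * L.s n (x - y)) := by
        refine (map_add_le_add _ _ _).trans (add_le_add (s_grow H n _) ((hg.lip n x y).trans ?_))
        gcongr
    _ ≤ (μ (n + 1) / μ n) ^ ν' * L.s n (x - y) +
        (μ (n + 1) / μ n) ^ ν' * ((μ (n + 1) / μ n - 1) * (1 * L.s n (x - y))) := by
        refine add_le_add le_rfl (le_mul_of_one_le_left ?_ h3)
        positivity
    _ = _ := by ring

theorem IsPerturbation.le_succ (H : GrowthBounds μ θ ν ν') (hc : SmallPerturbation θ ν ν' M c)
    (hg : L.IsPerturbation M c g) (n : ℕ) (x y : X) :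
    L.s n (x - y) ≤ (μ (n + 1) / μ n) ^ (ν' + 1) *
      L.s (n + 1) (A n x + g n x - (A n y + g n y)) := by
  have h0 := H.ratio_sub_one_nonneg n
  have hl := H.ratio_pos n
  have hs : 0 ≤ L.s n (x - y) := apply_nonneg _ _
  have hc0 := hc.lip_nonneg
  have hn := L.norm_le_s n (x - y)
  have h2 : A n (x - y) = A n x + g n x - (A n y + g n y) - (g n x - g n y) := by
    rw [map_sub]; abel
  have h3 : L.s (n + 1) (A n (x - y)) ≤ L.s (n + 1) (A n x + g n x - (A n y + g n y)) +
      (μ (n + 1) / μ n - 1) * (c * L.s n (x - y)) := by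
    rw [h2]
    refine (map_sub_le_add _ _ _).trans (add_le_add le_rfl ((hg.lip n x y).trans ?_))
    gcongr
  have h4 := (s_back H n (x - y)).trans (mul_le_mul_of_nonneg_left h3 (by positivity))
  have h5 := mul_le_mul_of_nonneg_right (lip_mul_le H hc n) hs
  set l := μ (n + 1) / μ n
  have h6 : l⁻¹ * L.s n (x - y) ≤
      l ^ ν' * L.s (n + 1) (A n x + g n x - (A n y + g n y)) := by linarith
  rw [inv_mul_le_iff₀ hl] at h6
  rw [Real.rpow_add_one hl.ne']
  linarith

theorem IsPerturbation.exists_equiv [CompleteSpace X] (H : GrowthBounds μ θ ν ν')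
    (hc : SmallPerturbation θ ν ν' M c) (hg : L.IsPerturbation M c g) :
    ∃ F : ℕ → X ≃ X, ∀ n x, F n x = A n x + g n x := by
  suffices h : ∀ n, Function.Bijective fun x => A n x + g n x from
    ⟨fun n => Equiv.ofBijective _ (h n), fun n x => rfl⟩
  refine fun n => ⟨fun x y hxy => ?_, fun v => ?_⟩
  · have h1 := hg.le_succ H hc n x y
    rw [sub_eq_zero.2 hxy, map_zero, mul_zero] at h1
    exact sub_eq_zero.1 (norm_le_zero_iff.1 ((L.norm_le_s n _).trans h1))
  · have hl := H.ratio_pos n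
    set l := μ (n + 1) / μ n
    have hl0 : 0 ≤ 1 - l⁻¹ := sub_nonneg.2 (inv_le_one_of_one_le₀ (H.one_le_ratio n))
    -- Preimages of v are the fixed points of x ↦ A_n^{-1}(v - g_n(x)), a contraction in the
    -- original, complete norm.
    have hcontr : ContractingWith (1 - l⁻¹).toNNReal fun x => (A n).symm (v - g n x) := by
      constructor
      · rw [← NNReal.coe_lt_coe, Real.coe_toNNReal _ hl0]
        simpa using hl
      · refine LipschitzWith.of_dist_le_mul fun x y => ?_
        rw [Real.coe_toNNReal _ hl0, dist_eq_norm, dist_eq_norm, ← map_sub]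
        have h1 : v - g n x - (v - g n y) = g n y - g n x := by abel
        calc _ ≤ L.s n ((A n).symm (v - g n x - (v - g n y))) := L.norm_le_s n _
          _ ≤ l ^ ν' * L.s (n + 1) (g n y - g n x) := by
            have := s_back (L := L) H n ((A n).symm (v - g n x - (v - g n y)))
            rw [ContinuousLinearEquiv.apply_symm_apply] at this
            rwa [h1] at this ⊢
          _ ≤ l ^ ν' * ((l - 1) * (c * ‖y - x‖)) := by gcongr; exact hg.lip n y x
          _ = l ^ ν' * ((l - 1) * c) * ‖x - y‖ := by rw [norm_sub_rev]; ring
          _ ≤ _ := by gcongr; exact lip_mul_le H hc n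
    have hfix := hcontr.fixedPoint_isFixedPt
    refine ⟨_, show _ + g n hcontr.fixedPoint = v from ?_⟩
    have h2 : (A n).symm (v - g n hcontr.fixedPoint) = hcontr.fixedPoint := hfix
    rw [← eq_sub_iff_add_eq, ← h2, ContinuousLinearEquiv.apply_symm_apply, h2]

/-- Interpolation: the Lipschitz bound serves distances at most 1, the uniform bound serves
distances at least 1. -/
theorem IsPerturbation.holder (H : GrowthBounds μ θ ν ν') (hc : SmallPerturbation θ ν ν' M c)
    (hg : L.IsPerturbation M c g) {ρ : ℝ} (hρ : 0 ≤ ρ) (hρ1 : ρ ≤ 1) (n : ℕ) (x y : X) :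
    L.s (n + 1) (g n x - g n y) ≤ (μ (n + 1) / μ n - 1) * ((2 * M + c) * L.s n (x - y) ^ ρ) := by
  have h0 := H.ratio_sub_one_nonneg n
  have hM := hc.bound_nonneg
  have hc0 := hc.lip_nonneg
  have hs : 0 ≤ L.s n (x - y) := apply_nonneg _ _
  rcases le_total (L.s n (x - y)) 1 with h | h
  · refine (hg.lip n x y).trans (mul_le_mul_of_nonneg_left ?_ h0)
    have h1 : L.s n (x - y) ≤ L.s n (x - y) ^ ρ := by
      simpa using Real.rpow_le_rpow_of_exponent_ge_of_imp hs h hρ1 (fun h h' => by simp_all)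
    have h2 := L.norm_le_s n (x - y)
    calc c * ‖x - y‖ ≤ c * L.s n (x - y) ^ ρ := by gcongr; exact h2.trans h1
      _ ≤ _ := by gcongr; linarith
  · have h1 := (map_sub_le_add (L.s (n + 1)) _ _).trans
      (add_le_add (hg.bound n x) (hg.bound n y))
    have h2 : 1 ≤ L.s n (x - y) ^ ρ := Real.one_le_rpow h hρ
    rw [← mul_add] at h1
    refine h1.trans (mul_le_mul_of_nonneg_left ?_ h0)
    calc M + M ≤ (2 * M + c) * 1 := by linarith
      _ ≤ _ := by gcongr

/-! ### Conjugacies: uniqueness, existence, Hölder regularity -/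

variable (L) in
/-- `w` maps orbits of `F` to orbits of `G`, stays at a bounded distance from the identity, and
does not move the stable component at time `0`. -/
structure IsConjugacy (F G : ℕ → X ≃ X) (w : ℕ → X → X) : Prop where
  conj : ∀ n x, w (n + 1) (F n x) = G n (w n x)
  init : ∀ x, L.p 0 (w 0 x - x) = 0
  bdd : ∃ E, ∀ n x, L.s n (w n x - x) ≤ E

theorem isConjugacy_id : L.IsConjugacy F F (fun _ x => x) where
  conj _ _ := rfl
  init x := by rw [sub_self, map_zero]
  bdd := ⟨0, fun n x => by rw [sub_self, map_zero]⟩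

theorem IsConjugacy.comp {F' : ℕ → X ≃ X} {w w' : ℕ → X → X} (h' : L.IsConjugacy G F' w')
    (h : L.IsConjugacy F G w) : L.IsConjugacy F F' (fun n x => w' n (w n x)) where
  conj n x := by rw [h.conj, h'.conj]
  init x := by
    have h1 := map_add_le_add (L.p 0) (w' 0 (w 0 x) - w 0 x) (w 0 x - x)
    rw [h.init, h'.init, add_zero, sub_add_sub_cancel] at h1
    exact le_antisymm h1 (apply_nonneg _ _)
  bdd := by
    obtain ⟨E, hE⟩ := h.bdd
    obtain ⟨E', hE'⟩ := h'.bdd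
    refine ⟨E' + E, fun n x => ?_⟩
    rw [← sub_add_sub_cancel _ (w n x)]
    exact (map_add_le_add _ _ _).trans (add_le_add (hE' n _) (hE n x))

theorem IsConjugacy.isSolution {w : ℕ → X → X} (hF : ∀ n x, F n x = A n x + f n x)
    (hG : ∀ n x, G n x = A n x + g n x) (h : L.IsConjugacy F G w) (n : ℕ) (x : X) :
    L.IsSolution
      (fun m => g m (w m (orbitThrough F n x m)) - f m (orbitThrough F n x m))
      (fun m => w m (orbitThrough F n x m) - orbitThrough F n x m) where
  step m := by
    rw [orbitThrough_succ, h.conj, hG, hF, map_sub]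
    abel
  init := h.init _
  bdd := by
    obtain ⟨E, hE⟩ := h.bdd
    exact ⟨E, fun m => hE m _⟩

/-- Along one orbit the two displacements differ by a solution whose forcing is pure feedback (B =
0), hence by zero. -/
theorem IsConjugacy.unique {w w' : ℕ → X → X} (H : GrowthBounds μ θ ν ν')
    (hc : SmallPerturbation θ ν ν' M c) (hg : L.IsPerturbation M c g)
    (hF : ∀ n x, F n x = A n x + f n x) (hG : ∀ n x, G n x = A n x + g n x)
    (h : L.IsConjugacy F G w) (h' : L.IsConjugacy F G w') (n : ℕ) (x : X) : w n x = w' n x := by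
  have h1 := ((h.isSolution hF hG n x).sub (h'.isSolution hF hG n x)).bound_feedback_const H
    (B := 0) le_rfl hc.lip_nonneg hc.lip_le (fun m => by
      rw [sub_sub_sub_cancel_right, sub_sub_sub_cancel_right, zero_add]
      have := H.ratio_sub_one_nonneg m
      have := hc.lip_nonneg
      refine (hg.lip m _ _).trans ?_
      gcongr
      exact L.norm_le_s m _) n
  rw [sub_sub_sub_cancel_right, mul_zero, orbitThrough_self] at h1
  exact sub_eq_zero.1 (norm_le_zero_iff.1 ((L.norm_le_s n _).trans h1))

theorem exists_isConjugacy [CompleteSpace X] (H : GrowthBounds μ θ ν ν')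
    (hc : SmallPerturbation θ ν ν' M c) (hf : L.IsPerturbation M c f)
    (hg : L.IsPerturbation M c g)
    (hF : ∀ n x, F n x = A n x + f n x) (hG : ∀ n x, G n x = A n x + g n x) :
    ∃ w, L.IsConjugacy F G w := by
  have hM := hc.bound_nonneg
  have hbd : ∀ (m : ℕ) (u v : X),
      L.s (m + 1) (g m u - f m v) ≤ (μ (m + 1) / μ m - 1) * (2 * M) := fun m u v => by
    have := (map_sub_le_add (L.s (m + 1)) _ _).trans (add_le_add (hg.bound m u) (hf.bound m v))
    linarith
  choose y hy using fun x : X => exists_isSolution_nonlinear (L := L) H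
    (r := fun m z => g m (iteratedFlow F m x + z) - f m (iteratedFlow F m x))
    (by positivity : 0 ≤ 2 * M) hc.lip_nonneg hc.lip_le (fun m z => hbd m _ _) (fun m z z' => by
      rw [sub_sub_sub_cancel_right]
      refine (hg.lip m _ _).trans ?_
      rw [add_sub_add_left_eq_sub]
      have := H.ratio_sub_one_nonneg m
      have := hc.lip_nonneg
      gcongr
      exact L.norm_le_s m _)
  -- The displacement is solved once per orbit, labelled by its point at time 0, so the conjugacy
  -- relation is the recursion for y.
  refine ⟨fun n x => x + y ((iteratedFlow F n).symm x) n, fun n x => ?_, fun x => ?_,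
    2 * greenConst θ ν * (2 * M), fun n x => ?_⟩
  · simp only [iteratedFlow_succ_symm]
    rw [(hy _).step, hF, hG, Equiv.apply_symm_apply, map_add]
    abel
  · rw [add_sub_cancel_left]
    exact (hy _).init
  · rw [add_sub_cancel_left]
    exact (hy _).bound_const H (by positivity) (fun m => hbd m _ _) n

/-- The displacements along the orbits through x and x' at time n differ by a solution forced by
feedback plus a Hölder term in the separation of the orbits. The exponent is fixed by (ν' + 1)ρ =
ν/2, the largest rate the weights may have. -/
theorem IsConjugacy.holder {w : ℕ → X → X} (H : GrowthBounds μ θ ν ν')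
    (hc : SmallPerturbation θ ν ν' M c) (hf : L.IsPerturbation M c f)
    (hg : L.IsPerturbation M c g) (hF : ∀ n x, F n x = A n x + f n x)
    (hG : ∀ n x, G n x = A n x + g n x) (h : L.IsConjugacy F G w) (n : ℕ) (x x' : X) :
    L.s n ((w n x - x) - (w n x' - x')) ≤
      8 * greenConst θ ν * (2 * M + c) * L.s n (x - x') ^ (ν / (2 * (ν' + 1))) := by
  have hν := H.exp_pos
  have hν' := H.exp'_pos
  have hνν' := H.exp_le
  have hM := hc.bound_nonneg
  have hc0 := hc.lip_nonneg
  set ρ := ν / (2 * (ν' + 1))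
  have hρ : 0 ≤ ρ := by positivity
  have hρ1 : ρ ≤ 1 := (div_le_one (by positivity)).2 (by linarith)
  set o := orbitThrough F n x
  set o' := orbitThrough F n x'
  set W : ℕ → ℝ := fun m => (max (μ m / μ n) (μ n / μ m)) ^ (ν / 2)
  have hmax : ∀ m, 0 < max (μ m / μ n) (μ n / μ m) :=
    fun m => one_pos.trans_le (H.one_le_max_ratio m n)
  have hd : ∀ m, L.s m (o m - o' m) ^ ρ ≤ W m * L.s n (x - x') ^ ρ := by
    intro m
    have h1 := H.le_max_ratio_rpow (d := fun m => L.s m (o m - o' m)) (a := ν' + 1) n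
      (fun m => by
        simp only [o, o', orbitThrough_succ, hF]
        exact hf.succ_le H hc m _ _)
      (fun m => by
        simp only [o, o', orbitThrough_succ, hF]
        exact hf.le_succ H hc m _ _) (by linarith) (apply_nonneg _ _) m
    simp only [o, o', orbitThrough_self] at h1
    refine (Real.rpow_le_rpow (apply_nonneg _ _) h1 hρ).trans_eq ?_
    rw [Real.mul_rpow (Real.rpow_nonneg (hmax m).le _) (apply_nonneg _ _),
      ← Real.rpow_mul (hmax m).le]
    congr 2
    simp only [ρ]
    field_simp
  have key := ((h.isSolution hF hG n x).sub (h.isSolution hF hG n x')).bound_feedback H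
    (B := 2 * (2 * M + c) * L.s n (x - x') ^ ρ) (W := W)
    (by have := Real.rpow_nonneg (apply_nonneg (L.s n) (x - x')) ρ; positivity)
    hc0 hc.lip_le
    (fun m => Real.one_le_rpow (H.one_le_max_ratio m n) (by linarith))
    (fun m => by
      rw [← Real.mul_rpow (H.ratio_pos m).le (hmax (m + 1)).le]
      exact Real.rpow_le_rpow (hmax m).le (H.max_ratio_le_succ m n) (by linarith))
    (fun m => by
      rw [← Real.mul_rpow (H.ratio_pos m).le (hmax m).le]
      exact Real.rpow_le_rpow (hmax (m + 1)).le (H.max_ratio_succ_le m n) (by linarith))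
    (fun m => by
      change L.s (m + 1) (g m (w m (o m)) - f m (o m) - (g m (w m (o' m)) - f m (o' m))) ≤
        (μ (m + 1) / μ m - 1) * (2 * (2 * M + c) * L.s n (x - x') ^ ρ * W m +
          c * L.s m (w m (o m) - o m - (w m (o' m) - o' m)))
      -- Intermediate point: between w(o) and v only the orbit changes (Hölder term), between v and
      -- w(o') only the displacement changes (feedback).
      set v := o' m + (w m (o m) - o m)
      have e : g m (w m (o m)) - f m (o m) - (g m (w m (o' m)) - f m (o' m)) =
        ((g m (w m (o m)) - g m v) - (f m (o m) - f m (o' m))) + (g m v - g m (w m (o' m))) := by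
        abel
      have e1 : w m (o m) - v = o m - o' m := by simp only [v]; abel
      have e2 : v - w m (o' m) = w m (o m) - o m - (w m (o' m) - o' m) := by simp only [v]; abel
      have b1 := hg.holder H hc hρ hρ1 m (w m (o m)) v
      have b2 := hf.holder H hc hρ hρ1 m (o m) (o' m)
      have b3 := hg.lip m v (w m (o' m))
      rw [e1] at b1
      rw [e2] at b3
      have h0 := H.ratio_sub_one_nonneg m
      rw [e]
      calc _ ≤ ((μ (m + 1) / μ m - 1) * ((2 * M + c) * (W m * L.s n (x - x') ^ ρ)) +
            (μ (m + 1) / μ m - 1) * ((2 * M + c) * (W m * L.s n (x - x') ^ ρ))) +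
            (μ (m + 1) / μ m - 1) * (c * L.s m (w m (o m) - o m - (w m (o' m) - o' m))) := by
            refine (map_add_le_add _ _ _).trans (add_le_add
              ((map_sub_le_add _ _ _).trans (add_le_add (b1.trans ?_) (b2.trans ?_)))
              (b3.trans ?_))
            · gcongr
              exact hd m
            · gcongr
              exact hd m
            · gcongr
              exact L.norm_le_s m _
        _ = _ := by ring) n
  have hWn : W n = 1 := by simp [W, div_self (H.pos n).ne']
  simp only [orbitThrough_self, hWn, mul_one] at key
  refine key.trans_eq ?_
  ring

end

end AdaptedNorms

/-! ### Construction of the adapted norms -/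

section WeightedSup

variable {𝕜 X : Type*} [RCLike 𝕜] [NormedAddCommGroup X] [NormedSpace 𝕜 X]

/-- The seminorm `x ↦ sup_k w k * ‖T k x‖`. -/
noncomputable def weightedSup (w : ℕ → ℝ) (T : ℕ → X →L[𝕜] X) (K : ℝ) (hw : ∀ k, 0 ≤ w k)
    (hK : ∀ k x, w k * ‖T k x‖ ≤ K * ‖x‖) : AddGroupSeminorm X where
  toFun x := ⨆ k, w k * ‖T k x‖
  map_zero' := by simp
  add_le' x y := by
    have hb : ∀ x, BddAbove (Set.range fun k => w k * ‖T k x‖) := fun x =>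
      ⟨K * ‖x‖, by rintro _ ⟨k, rfl⟩; exact hK k x⟩
    refine ciSup_le fun k => ?_
    rw [map_add]
    refine (mul_le_mul_of_nonneg_left (norm_add_le _ _) (hw k)).trans ?_
    rw [mul_add]
    exact add_le_add (le_ciSup (hb x) k) (le_ciSup (hb y) k)
  neg' x := by simp

variable {w : ℕ → ℝ} {T : ℕ → X →L[𝕜] X} {K : ℝ} {hw : ∀ k, 0 ≤ w k}
  {hK : ∀ k x, w k * ‖T k x‖ ≤ K * ‖x‖}

theorem weightedSup_le {x : X} {B : ℝ} (h : ∀ k, w k * ‖T k x‖ ≤ B) :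
    weightedSup w T K hw hK x ≤ B := ciSup_le h

theorem le_weightedSup (x : X) (k : ℕ) : w k * ‖T k x‖ ≤ weightedSup w T K hw hK x :=
  le_ciSup (f := fun k => w k * ‖T k x‖) ⟨K * ‖x‖, by rintro _ ⟨k, rfl⟩; exact hK k x⟩ k

theorem weightedSup_le_mul {w' : ℕ → ℝ} {T' : ℕ → X →L[𝕜] X} {K' : ℝ} {hw' : ∀ k, 0 ≤ w' k}
    {hK' : ∀ k x, w' k * ‖T' k x‖ ≤ K' * ‖x‖} {c : ℝ} {x x' : X} (hc : 0 ≤ c)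
    (h : ∀ k, w k ≤ c * w' k) (hT : ∀ k, T k x = T' k x') :
    weightedSup w T K hw hK x ≤ c * weightedSup w' T' K' hw' hK' x' := by
  refine weightedSup_le fun k => ?_
  rw [hT]
  calc w k * ‖T' k x'‖ ≤ c * w' k * ‖T' k x'‖ := by gcongr; exact h k
    _ = c * (w' k * ‖T' k x'‖) := mul_assoc _ _ _
    _ ≤ _ := by gcongr; exact le_weightedSup _ _

theorem weightedSup_eq_zero {x : X} (h : ∀ k, T k x = 0) : weightedSup w T K hw hK x = 0 :=
  le_antisymm (weightedSup_le fun k => by simp [h]) (apply_nonneg _ _)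

end WeightedSup

/-- The weight `min (t ^ ν) (t ^ ν')` of the adapted norms. -/
noncomputable def adaptedWeight (ν ν' t : ℝ) : ℝ := min (t ^ ν) (t ^ ν')

section AdaptedWeight

variable {ν ν' t l : ℝ}

theorem adaptedWeight_nonneg (ht : 0 ≤ t) : 0 ≤ adaptedWeight ν ν' t :=
  le_min (Real.rpow_nonneg ht _) (Real.rpow_nonneg ht _)

theorem adaptedWeight_one : adaptedWeight ν ν' 1 = 1 := by simp [adaptedWeight]

/-- The minimum is t^ν for t ≥ 1 and t^{ν'} for t ≤ 1. Rescaling t thus costs a power between ν and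
ν', which yields the one-step rates with constant one. -/
theorem adaptedWeight_div_le (hν : ν ≤ ν') (hl : 1 ≤ l) (ht : 0 ≤ t) :
    adaptedWeight ν ν' (t / l) ≤ l ^ (-ν) * adaptedWeight ν ν' t := by
  have h0 : 0 < l := by linarith
  unfold adaptedWeight
  rw [Real.div_rpow ht h0.le, Real.div_rpow ht h0.le, mul_min_of_nonneg _ _ (by positivity),
    Real.rpow_neg h0.le, ← div_eq_inv_mul, ← div_eq_inv_mul]
  refine min_le_min le_rfl ?_
  gcongr

theorem adaptedWeight_mul_le (hν : ν ≤ ν') (hl : 1 ≤ l) (ht : 0 ≤ t) :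
    adaptedWeight ν ν' (l * t) ≤ l ^ ν' * adaptedWeight ν ν' t := by
  have h0 : 0 < l := by linarith
  unfold adaptedWeight
  rw [Real.mul_rpow h0.le ht, Real.mul_rpow h0.le ht, mul_min_of_nonneg _ _ (by positivity)]
  refine min_le_min ?_ le_rfl
  gcongr

end AdaptedWeight

/-- A strong nonuniform dichotomy with bounds `C k` for the linear flow. -/
structure FlowDichotomy {𝕜 X : Type*} [RCLike 𝕜] [NormedAddCommGroup X] [NormedSpace 𝕜 X]
    (A : ℕ → X ≃L[𝕜] X) (P : ℕ → X →L[𝕜] X) (μ : ℕ → ℝ) (ν ν' : ℝ) (C : ℕ → ℝ) : Prop where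
  idem : ∀ k x, P k (P k x) = P k x
  comm : ∀ k x, A k (P k x) = P (k + 1) (A k x)
  stable : ∀ m k x, k ≤ m → ‖linearFlow A m ((linearFlow A k).symm (P k x))‖ ≤
    (μ m / μ k) ^ (-ν) * (C k * ‖x‖)
  unstable : ∀ m k x, k ≤ m → ‖linearFlow A m ((linearFlow A k).symm (x - P k x))‖ ≤
    (μ m / μ k) ^ ν' * (C k * ‖x‖)
  stable_back : ∀ m k x, m ≤ k → ‖linearFlow A m ((linearFlow A k).symm (P k x))‖ ≤
    (μ k / μ m) ^ ν' * (C k * ‖x‖)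
  unstable_back : ∀ m k x, m ≤ k → ‖linearFlow A m ((linearFlow A k).symm (x - P k x))‖ ≤
    (μ k / μ m) ^ (-ν) * (C k * ‖x‖)

namespace FlowDichotomy

variable {𝕜 X : Type*} [RCLike 𝕜] [NormedAddCommGroup X] [NormedSpace 𝕜 X]
  {A : ℕ → X ≃L[𝕜] X} {P : ℕ → X →L[𝕜] X} {μ : ℕ → ℝ} {θ ν ν' : ℝ} {C : ℕ → ℝ}

variable (A P) in
/-- The stable part of the evolution from time `n` to time `k`. -/
def stablePart (n k : ℕ) : X →L[𝕜] X :=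
  (((linearFlow A n).symm.trans (linearFlow A k) : X ≃L[𝕜] X) : X →L[𝕜] X).comp (P n)

variable (A P) in
/-- The unstable part of the evolution from time `n` to time `k`. -/
def unstablePart (n k : ℕ) : X →L[𝕜] X :=
  (((linearFlow A n).symm.trans (linearFlow A k) : X ≃L[𝕜] X) : X →L[𝕜] X).comp
    (ContinuousLinearMap.id 𝕜 X - P n)

theorem stablePart_apply (n k : ℕ) (x : X) :
    stablePart A P n k x = linearFlow A k ((linearFlow A n).symm (P n x)) := rfl

theorem unstablePart_apply (n k : ℕ) (x : X) :
    unstablePart A P n k x = linearFlow A k ((linearFlow A n).symm (x - P n x)) := rfl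

theorem linearFlow_succ_symm_apply (n : ℕ) (x : X) :
    (linearFlow A (n + 1)).symm (A n x) = (linearFlow A n).symm x := by
  rw [ContinuousLinearEquiv.symm_apply_eq]
  change A n x = A n (linearFlow A n ((linearFlow A n).symm x))
  rw [ContinuousLinearEquiv.apply_symm_apply]

variable (D : FlowDichotomy A P μ ν ν' C)
include D

theorem stablePart_succ (n k : ℕ) (x : X) :
    stablePart A P (n + 1) k (A n x) = stablePart A P n k x := by
  rw [stablePart_apply, stablePart_apply, ← D.comm, linearFlow_succ_symm_apply]

theorem unstablePart_succ (n k : ℕ) (x : X) :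
    unstablePart A P (n + 1) k (A n x) = unstablePart A P n k x := by
  rw [unstablePart_apply, unstablePart_apply, ← D.comm, ← map_sub, linearFlow_succ_symm_apply]

/-- The weight cancels the dichotomy rate, t^ν in the future and t^{ν'} in the past, so the supremum
over all times k is finite. -/
theorem stable_weight_le (H : GrowthBounds μ θ ν ν') (n k : ℕ) (x : X) :
    adaptedWeight ν ν' (μ k / μ n) * ‖stablePart A P n k x‖ ≤ C n * ‖x‖ := by
  have hp : 0 < μ k / μ n := div_pos (H.pos _) (H.pos _)
  rw [stablePart_apply]
  rcases le_total n k with h | h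
  · calc _ ≤ (μ k / μ n) ^ ν * ((μ k / μ n) ^ (-ν) * (C n * ‖x‖)) :=
        mul_le_mul (min_le_left _ _) (D.stable k n x h) (norm_nonneg _) (by positivity)
      _ = _ := by rw [← mul_assoc, ← Real.rpow_add hp]; simp
  · calc _ ≤ (μ k / μ n) ^ ν' * ((μ n / μ k) ^ ν' * (C n * ‖x‖)) :=
        mul_le_mul (min_le_right _ _) (D.stable_back k n x h) (norm_nonneg _) (by positivity)
      _ = _ := by
        rw [← inv_div (μ k), Real.inv_rpow hp.le, ← mul_assoc, mul_inv_cancel₀, one_mul]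
        positivity

theorem unstable_weight_le (H : GrowthBounds μ θ ν ν') (n k : ℕ) (x : X) :
    adaptedWeight ν ν' (μ n / μ k) * ‖unstablePart A P n k x‖ ≤ C n * ‖x‖ := by
  have hp : 0 < μ n / μ k := div_pos (H.pos _) (H.pos _)
  rw [unstablePart_apply]
  rcases le_total k n with h | h
  · calc _ ≤ (μ n / μ k) ^ ν * ((μ n / μ k) ^ (-ν) * (C n * ‖x‖)) :=
        mul_le_mul (min_le_left _ _) (D.unstable_back k n x h) (norm_nonneg _) (by positivity)
      _ = _ := by rw [← mul_assoc, ← Real.rpow_add hp]; simp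
  · calc _ ≤ (μ n / μ k) ^ ν' * ((μ k / μ n) ^ ν' * (C n * ‖x‖)) :=
        mul_le_mul (min_le_right _ _) (D.unstable k n x h) (norm_nonneg _) (by positivity)
      _ = _ := by
        rw [← inv_div (μ n), Real.inv_rpow hp.le, ← mul_assoc, mul_inv_cancel₀, one_mul]
        positivity

/-- The adapted norms of a dichotomy. -/
noncomputable def adaptedNorms (H : GrowthBounds μ θ ν ν') : AdaptedNorms A μ ν ν' C where
  p n := weightedSup (fun k => adaptedWeight ν ν' (μ k / μ n)) (stablePart A P n) (C n)
    (fun _ => adaptedWeight_nonneg (div_pos (H.pos _) (H.pos _)).le) (D.stable_weight_le H n)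
  q n := weightedSup (fun k => adaptedWeight ν ν' (μ n / μ k)) (unstablePart A P n) (C n)
    (fun _ => adaptedWeight_nonneg (div_pos (H.pos _) (H.pos _)).le) (D.unstable_weight_le H n)
  norm_le n x := by
    have h1 := le_weightedSup (hw := fun _ =>
      adaptedWeight_nonneg (div_pos (H.pos _) (H.pos _)).le) (hK := D.stable_weight_le H n) x n
    have h2 := le_weightedSup (hw := fun _ =>
      adaptedWeight_nonneg (div_pos (H.pos _) (H.pos _)).le) (hK := D.unstable_weight_le H n) x n
    rw [div_self (H.pos n).ne', adaptedWeight_one, one_mul, stablePart_apply,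
      ContinuousLinearEquiv.apply_symm_apply] at h1
    rw [div_self (H.pos n).ne', adaptedWeight_one, one_mul, unstablePart_apply,
      ContinuousLinearEquiv.apply_symm_apply] at h2
    calc ‖x‖ = ‖P n x + (x - P n x)‖ := by rw [add_sub_cancel]
      _ ≤ _ := (norm_add_le _ _).trans (add_le_add h1 h2)
  p_le n x := weightedSup_le fun k => D.stable_weight_le H n k x
  q_le n x := weightedSup_le fun k => D.unstable_weight_le H n k x
  -- Passing from n to n + 1 keeps the vectors in the supremum and only rescales their weights; the
  -- same holds for the next three fields.
  p_step n x := weightedSup_le_mul (Real.rpow_nonneg (H.ratio_pos n).le _) (fun k => by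
      have h := adaptedWeight_div_le H.exp_le (H.one_le_ratio n)
        (div_pos (H.pos k) (H.pos n)).le
      rwa [div_div_div_cancel_right₀ (H.pos n).ne'] at h) (fun k => D.stablePart_succ n k x)
  p_back n x := weightedSup_le_mul (Real.rpow_nonneg (H.ratio_pos n).le _) (fun k => by
      have h := adaptedWeight_mul_le H.exp_le (H.one_le_ratio n)
        (div_pos (H.pos k) (H.pos (n + 1))).le
      rwa [mul_comm (_ / _) (_ / _), div_mul_div_cancel₀ (H.pos (n + 1)).ne'] at h)
      (fun k => (D.stablePart_succ n k x).symm)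
  q_step n x := weightedSup_le_mul (Real.rpow_nonneg (H.ratio_pos n).le _) (fun k => by
      have h := adaptedWeight_div_le H.exp_le (H.one_le_ratio n)
        (div_pos (H.pos (n + 1)) (H.pos k)).le
      rwa [div_div_div_cancel_left' _ _ (H.pos (n + 1)).ne'] at h)
      (fun k => (D.unstablePart_succ n k x).symm)
  q_grow n x := weightedSup_le_mul (Real.rpow_nonneg (H.ratio_pos n).le _) (fun k => by
      have h := adaptedWeight_mul_le H.exp_le (H.one_le_ratio n)
        (div_pos (H.pos n) (H.pos k)).le
      rwa [div_mul_div_cancel₀ (H.pos n).ne'] at h) (fun k => D.unstablePart_succ n k x)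
  split n x := ⟨P n x,
    weightedSup_eq_zero fun k => by
      rw [stablePart_apply, map_sub, D.idem, sub_self, map_zero, map_zero],
    weightedSup_eq_zero fun k => by
      rw [unstablePart_apply, D.idem, sub_self, map_zero, map_zero]⟩

end FlowDichotomy

/-! ### From the evolution family to the shifted linear flow -/

theorem stepProduct_eq_linearFlow {𝕜 X : Type*} [RCLike 𝕜] [NormedAddCommGroup X]
    [NormedSpace 𝕜 X] {A : ℕ → X →L[𝕜] X} {E : ℕ → X ≃L[𝕜] X} (hE : ∀ i x, E i x = A (i + 1) x)
    (k j : ℕ) : stepProduct A (k + 1) j =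
      ((linearFlow E k).symm.trans (linearFlow E (k + j)) : X ≃L[𝕜] X) := by
  induction j with
  | zero => ext x; simp [stepProduct]
  | succ j ih =>
    ext x
    rw [stepProduct, ih]
    simp only [ContinuousLinearMap.comp_apply, ContinuousLinearEquiv.coe_coe,
      ContinuousLinearEquiv.trans_apply]
    rw [show k + 1 + j = k + j + 1 by ring, ← hE]
    rfl

theorem evolution_eq_linearFlow {𝕜 X : Type*} [RCLike 𝕜] [NormedAddCommGroup X]
    [NormedSpace 𝕜 X] {A : ℕ → X →L[𝕜] X} {E : ℕ → X ≃L[𝕜] X} (hE : ∀ i x, E i x = A (i + 1) x)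
    (m k : ℕ) : evolution A (m + 1) (k + 1) =
      ((linearFlow E k).symm.trans (linearFlow E m) : X ≃L[𝕜] X) := by
  unfold evolution
  split_ifs with h
  · rw [stepProduct_eq_linearFlow hE, Nat.add_sub_add_right, Nat.add_sub_cancel' (by omega)]
  · rw [stepProduct_eq_linearFlow hE, Nat.add_sub_add_right, Nat.add_sub_cancel' (by omega),
      ContinuousLinearMap.ringInverse_equiv, ContinuousLinearMap.inverse_equiv]
    rfl

/-- A strong nonuniform dichotomy for the indices `n ≥ 1`, shifted to start at `0`. -/
theorem StrongNonuniformDichotomy.exists_flowDichotomy {𝕜 X : Type*} [RCLike 𝕜]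
    [NormedAddCommGroup X] [NormedSpace 𝕜 X] {A : ℕ → X →L[𝕜] X} {μ : ℕ → ℝ} {ε : ℝ}
    (h : StrongNonuniformDichotomy A μ ε) :
    ∃ (E : ℕ → X ≃L[𝕜] X) (P : ℕ → X →L[𝕜] X) (N ν ν' : ℝ), (∀ i x, E i x = A (i + 1) x) ∧
      1 ≤ N ∧ 0 < ν ∧ ν ≤ ν' ∧
      FlowDichotomy E P (fun i => μ (i + 1)) ν ν' (fun i => N * μ (i + 1) ^ ε) := by
  obtain ⟨-, hu, P, N, ν, ν', hN, hν, hνν', hidem, hcomm, hfor, hback⟩ := h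
  set E : ℕ → X ≃L[𝕜] X := fun i =>
    ContinuousLinearEquiv.unitsEquiv 𝕜 X (hu (i + 1) (by omega)).unit with hEdef
  have hE : ∀ i x, E i x = A (i + 1) x := fun i x => rfl
  refine ⟨E, fun i => P (i + 1), N, ν, ν', hE, hN, hν, hνν', ?_⟩
  have key : ∀ (m k : ℕ) (Q : X →L[𝕜] X) (a b : ℝ) (x : X),
      ‖(evolution A (m + 1) (k + 1)).comp Q‖ ≤ N * a * b →
      ‖linearFlow E m ((linearFlow E k).symm (Q x))‖ ≤ a * (N * b * ‖x‖) := by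
    intro m k Q a b x hb
    rw [evolution_eq_linearFlow hE] at hb
    have h1 := ContinuousLinearMap.le_of_opNorm_le _ hb x
    calc _ ≤ _ := h1
      _ = _ := by ring
  exact
    { idem := fun k x => DFunLike.congr_fun (hidem (k + 1) (by omega)) x
      comm := fun k x => DFunLike.congr_fun (hcomm (k + 1) (by omega)) x
      stable := fun m k x hk =>
        key m k _ _ _ x (hfor (m + 1) (k + 1) (by omega) (by omega)).1
      unstable := fun m k x hk =>
        key m k _ _ _ x (hfor (m + 1) (k + 1) (by omega) (by omega)).2
      stable_back := fun m k x hk =>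
        key m k _ _ _ x (hback (m + 1) (k + 1) (by omega) (by omega)).2
      unstable_back := fun m k x hk =>
        key m k _ _ _ x (hback (m + 1) (k + 1) (by omega) (by omega)).1 }

/-! ### Return to the original norm and conclusion -/

namespace AdaptedNorms

variable {𝕜 X : Type*} [RCLike 𝕜] [NormedAddCommGroup X] [NormedSpace 𝕜 X]
  {A : ℕ → X ≃L[𝕜] X} {μ : ℕ → ℝ} {θ ν ν' : ℝ} {C : ℕ → ℝ} {L : AdaptedNorms A μ ν ν' C}
  {f g : ℕ → X → X} {M c : ℝ} {F G : ℕ → X ≃ X}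

theorem IsConjugacy.norm_sub_le {w : ℕ → X → X} (H : GrowthBounds μ θ ν ν')
    (hc : SmallPerturbation θ ν ν' M c) (hf : L.IsPerturbation M c f)
    (hg : L.IsPerturbation M c g) (hF : ∀ n x, F n x = A n x + f n x)
    (hG : ∀ n x, G n x = A n x + g n x) (h : L.IsConjugacy F G w) (n : ℕ) (x y : X) :
    ‖w n x - w n y‖ ≤ ‖x - y‖ +
      8 * greenConst θ ν * (2 * M + c) * (2 * C n * ‖x - y‖) ^ (ν / (2 * (ν' + 1))) := by
  have hν := H.exp_pos
  have hν' := H.exp'_pos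
  have hK := H.greenConst_pos
  have hM := hc.bound_nonneg
  have hc0 := hc.lip_nonneg
  have h1 : w n x - w n y = (x - y) + ((w n x - x) - (w n y - y)) := by abel
  rw [h1]
  refine (norm_add_le _ _).trans (add_le_add le_rfl ?_)
  refine (L.norm_le_s n _).trans ((h.holder H hc hf hg hF hG n x y).trans ?_)
  exact mul_le_mul_of_nonneg_left
    (Real.rpow_le_rpow (apply_nonneg _ _) (L.s_le n _) (by positivity)) (by positivity)

theorem IsConjugacy.continuous {w : ℕ → X → X} (H : GrowthBounds μ θ ν ν')
    (hc : SmallPerturbation θ ν ν' M c) (hf : L.IsPerturbation M c f)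
    (hg : L.IsPerturbation M c g) (hF : ∀ n x, F n x = A n x + f n x)
    (hG : ∀ n x, G n x = A n x + g n x) (h : L.IsConjugacy F G w) (n : ℕ) :
    Continuous (w n) := by
  have hν := H.exp_pos
  have hν' := H.exp'_pos
  refine continuous_iff_continuousAt.2 fun y => ?_
  rw [ContinuousAt, tendsto_iff_norm_sub_tendsto_zero]
  refine squeeze_zero (fun _ => norm_nonneg _)
    (fun x => h.norm_sub_le H hc hf hg hF hG n x y) ?_
  have hρ : 0 < ν / (2 * (ν' + 1)) := by positivity
  have h1 : Continuous fun x => ‖x - y‖ +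
      8 * greenConst θ ν * (2 * M + c) * (2 * C n * ‖x - y‖) ^ (ν / (2 * (ν' + 1))) := by
    have h2 : Continuous fun x => (2 * C n * ‖x - y‖) ^ (ν / (2 * (ν' + 1))) :=
      (by fun_prop : Continuous fun x => 2 * C n * ‖x - y‖).rpow_const fun _ => Or.inr hρ.le
    fun_prop
  have h2 := h1.tendsto y
  simpa [Real.zero_rpow hρ.ne'] using h2

/-- Each composite of the two conjugacies is a self-conjugacy, as is the identity, so uniqueness
makes them inverse to each other. -/
theorem exists_homeomorph [CompleteSpace X] (H : GrowthBounds μ θ ν ν')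
    (hc : SmallPerturbation θ ν ν' M c) (hf : L.IsPerturbation M c f)
    (hg : L.IsPerturbation M c g)
    (hF : ∀ n x, F n x = A n x + f n x) (hG : ∀ n x, G n x = A n x + g n x) :
    ∃ h : ℕ → X ≃ₜ X, L.IsConjugacy F G (fun n => h n) ∧
      L.IsConjugacy G F (fun n => (h n).symm) := by
  obtain ⟨w, hw⟩ := exists_isConjugacy H hc hf hg hF hG
  obtain ⟨w', hw'⟩ := exists_isConjugacy H hc hg hf hG hF
  have h1 : ∀ n x, w' n (w n x) = x := (hw'.comp hw).unique H hc hf hF hF isConjugacy_id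
  have h2 : ∀ n x, w n (w' n x) = x := (hw.comp hw').unique H hc hg hG hG isConjugacy_id
  exact ⟨fun n => ⟨⟨w n, w' n, h1 n, h2 n⟩, hw.continuous H hc hf hg hF hG n,
    hw'.continuous H hc hg hf hG hF n⟩, hw, hw'⟩

/-- The norm s_{n+1} costs 2Nμ_{n+1}^ε ≤ 2Nθ^ε μ_n^ε, which μ_n^{-ε} cancels; the remaining μ_n'/μ_n
is the ratio minus one. -/
theorem isPerturbation_of_norm_le (H : GrowthBounds μ θ ν ν') {N ε : ℝ}
    {L : AdaptedNorms A μ ν ν' (fun i => N * μ i ^ ε)} (hN : 0 ≤ N) (hε : 0 ≤ ε) (hM : 0 ≤ M)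
    (hc : 0 ≤ c)
    (hb : ∀ n x, ‖g n x‖ ≤ M * (μ (n + 1) - μ n) * μ n ^ (-(1 + ε)))
    (hl : ∀ n x y, ‖g n x - g n y‖ ≤ c * (μ (n + 1) - μ n) * μ n ^ (-(1 + ε)) * ‖x - y‖) :
    L.IsPerturbation (2 * N * θ ^ ε * M) (2 * N * θ ^ ε * c) g := by
  have key : ∀ n, μ (n + 1) ^ ε * ((μ (n + 1) - μ n) * μ n ^ (-(1 + ε))) ≤
      (μ (n + 1) / μ n - 1) * θ ^ ε := by
    intro n
    have hp := H.pos n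
    have hr := H.ratio_pos n
    have h0 := H.ratio_sub_one_nonneg n
    have h1 : μ n ^ (-(1 + ε)) = (μ n)⁻¹ * (μ n ^ ε)⁻¹ := by
      rw [neg_add, Real.rpow_add hp, Real.rpow_neg_one, Real.rpow_neg hp.le]
    calc _ = (μ (n + 1) / μ n - 1) * (μ (n + 1) / μ n) ^ ε := by
          rw [h1, Real.div_rpow (H.pos _).le hp.le]
          have := Real.rpow_pos_of_pos hp ε
          field_simp
      _ ≤ _ := by
          gcongr
          exact H.ratio_le n
  have hpow : ∀ n, 0 ≤ μ (n + 1) ^ ε := fun n => (Real.rpow_pos_of_pos (H.pos _) _).le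
  refine ⟨fun n x => ?_, fun n x y => ?_⟩
  · have := hpow n
    calc _ ≤ 2 * (N * μ (n + 1) ^ ε) * ‖g n x‖ := L.s_le _ _
      _ ≤ 2 * (N * μ (n + 1) ^ ε) * (M * (μ (n + 1) - μ n) * μ n ^ (-(1 + ε))) := by
        gcongr
        exact hb n x
      _ = 2 * N * M * (μ (n + 1) ^ ε * ((μ (n + 1) - μ n) * μ n ^ (-(1 + ε)))) := by ring
      _ ≤ 2 * N * M * ((μ (n + 1) / μ n - 1) * θ ^ ε) := by
        exact mul_le_mul_of_nonneg_left (key n) (by positivity)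
      _ = _ := by ring
  · have := hpow n
    calc _ ≤ 2 * (N * μ (n + 1) ^ ε) * ‖g n x - g n y‖ := L.s_le _ _
      _ ≤ 2 * (N * μ (n + 1) ^ ε) *
          (c * (μ (n + 1) - μ n) * μ n ^ (-(1 + ε)) * ‖x - y‖) := by
        gcongr
        exact hl n x y
      _ = 2 * N * c * ‖x - y‖ * (μ (n + 1) ^ ε * ((μ (n + 1) - μ n) * μ n ^ (-(1 + ε)))) := by
        ring
      _ ≤ 2 * N * c * ‖x - y‖ * ((μ (n + 1) / μ n - 1) * θ ^ ε) := by
        exact mul_le_mul_of_nonneg_left (key n) (by positivity)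
      _ = _ := by ring

end AdaptedNorms

/-- A Lipschitz term is dominated by a Hölder term on small scales. -/
theorem add_rpow_le_of_le_rpow_neg {N m ε ρ r H : ℝ} (hN : 0 ≤ N) (hm : 1 ≤ m) (hε : 0 ≤ ε)
    (hρ : 0 ≤ ρ) (hρ1 : ρ ≤ 1) (hr : 0 ≤ r) (hrm : r ≤ m ^ (-ε)) :
    r + H * (2 * (N * m ^ ε) * r) ^ ρ ≤ (1 + H * (2 * N) ^ ρ) * m ^ (ρ * ε) * r ^ ρ := by
  have hm0 : 0 < m := by linarith
  have hr1 : r ≤ 1 := hrm.trans (Real.rpow_le_one_of_one_le_of_nonpos hm (by linarith))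
  have h1 : r ≤ r ^ ρ := by
    simpa using Real.rpow_le_rpow_of_exponent_ge_of_imp hr hr1 hρ1 (fun h h' => by simp_all)
  have h2 : 1 ≤ m ^ (ρ * ε) := Real.one_le_rpow hm (by positivity)
  have h3 : (2 * (N * m ^ ε) * r) ^ ρ = (2 * N) ^ ρ * m ^ (ρ * ε) * r ^ ρ := by
    rw [← mul_assoc, Real.mul_rpow (by positivity) hr, Real.mul_rpow (by positivity) (by positivity),
      ← Real.rpow_mul hm0.le, mul_comm ε ρ]
  have h4 : r ≤ m ^ (ρ * ε) * r ^ ρ :=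
    h1.trans (le_mul_of_one_le_left (Real.rpow_nonneg hr _) h2)
  rw [h3]
  linarith

theorem mainTheorem7 {𝕜 X : Type*} [RCLike 𝕜] [NormedAddCommGroup X] [NormedSpace 𝕜 X]
    [CompleteSpace X] (μ : ℕ → ℝ) (hμ : IsGrowthRate μ)
    (θ : ℝ) (hθ : 1 ≤ θ) (hμθ : ∀ n, μ (n + 1) / μ n ≤ θ)
    (A : ℕ → X →L[𝕜] X) (ε : ℝ) (hA : StrongNonuniformDichotomy A μ ε) :
    ∃ c₀ : ℝ, 0 < c₀ ∧
      ∀ (g : ℕ → X → X) (M c : ℝ), 0 < M → 0 < c → c ≤ c₀ →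
        (∀ n, 1 ≤ n → ∀ x : X, ‖g n x‖ ≤ M * (μ (n + 1) - μ n) * μ n ^ (-(1 + ε))) →
        (∀ n, 1 ≤ n → ∀ x y : X,
          ‖g n x - g n y‖ ≤ c * (μ (n + 1) - μ n) * μ n ^ (-(1 + ε)) * ‖x - y‖) →
        ∃ h : ℕ → X ≃ₜ X,
          (∀ n, 1 ≤ n → ∀ x : X, h (n + 1) (A n x + g n x) = A n (h n x)) ∧
          (∃ D : ℝ, 0 < D ∧ ∀ n, 1 ≤ n → ∀ x : X,
            ‖h n x - x‖ ≤ D ∧ ‖(h n).symm x - x‖ ≤ D) ∧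
          (∃ K ρ δ : ℝ, 0 < K ∧ 0 < ρ ∧ 0 < δ ∧
            ∀ n, 1 ≤ n → ∀ x y : X, ‖x - y‖ ≤ δ * μ n ^ (-ε) →
              ‖h n x - h n y‖ ≤ K * μ n ^ (ρ * ε) * ‖x - y‖ ^ ρ ∧
              ‖(h n).symm x - (h n).symm y‖ ≤ K * μ n ^ (ρ * ε) * ‖x - y‖ ^ ρ) := by
  have hε : 0 ≤ ε := hA.1
  obtain ⟨E, P, N, ν, ν', hE, hN, hν, hνν', D⟩ := hA.exists_flowDichotomy
  have H : GrowthBounds (fun i => μ (i + 1)) θ ν ν' :=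
    { pos := fun n => hμ.pos _
      mono := fun a b hab => hμ.strictMono.monotone (by omega)
      tendsto_atTop := (tendsto_add_atTop_iff_nat 1).2 hμ.tendsto_atTop
      ratio_le := fun n => hμθ _
      exp_pos := hν
      exp_le := hνν' }
  have hν' := H.exp'_pos
  have hK := H.greenConst_pos
  have hμ1 : ∀ n, 1 ≤ μ n := fun n => hμ.zero ▸ hμ.strictMono.monotone (Nat.zero_le n)
  have hθ0 : 0 < θ := by linarith
  have hN0 : 0 < N := by linarith
  set L := D.adaptedNorms H
  set T := 2 * N * θ ^ ε
  have hT : 0 < T := by positivity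
  -- The minimum collects the thresholds for solvability and for invertibility; T converts c to the
  -- adapted norms.
  refine ⟨min (1 / (4 * greenConst θ ν)) (θ ^ (-(ν' + 1))) / T, by positivity, ?_⟩
  intro g M c hM hc hcc hb hl
  rw [le_div_iff₀' hT] at hcc
  have hsmall : SmallPerturbation θ ν ν' (T * M) (T * c) :=
    { bound_nonneg := by positivity
      lip_nonneg := by positivity
      lip_le := by
        have := hcc.trans (min_le_left _ _)
        rwa [le_div_iff₀' (by positivity)] at this
      lip_le' := hcc.trans (min_le_right _ _) }
  have hpert : L.IsPerturbation (T * M) (T * c) (fun i => g (i + 1)) :=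
    AdaptedNorms.isPerturbation_of_norm_le H hN0.le hε hM.le hc.le
      (fun n x => hb (n + 1) (by omega) x) (fun n x y => hl (n + 1) (by omega) x y)
  have hzero : L.IsPerturbation (T * M) (T * c) (fun _ _ => 0) :=
    AdaptedNorms.isPerturbation_zero H hsmall.bound_nonneg hsmall.lip_nonneg
  obtain ⟨F, hF⟩ := hpert.exists_equiv H hsmall
  have hG : ∀ n x, (E n).toEquiv x = E n x + 0 := fun n x => (add_zero _).symm
  obtain ⟨h, hh, hh'⟩ := AdaptedNorms.exists_homeomorph H hsmall hpert hzero hF hG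
  obtain ⟨D₁, hD₁⟩ := hh.bdd
  obtain ⟨D₂, hD₂⟩ := hh'.bdd
  -- This undoes the shift of indices; the value at n = 0 is irrelevant.
  refine ⟨fun n => h (n - 1), ?_, ⟨max 1 (max D₁ D₂), by positivity, ?_⟩, ?_⟩
  · intro n hn x
    obtain ⟨n, rfl⟩ := Nat.exists_eq_add_of_le' hn
    have h1 := hh.conj n x
    rw [hF, hE] at h1
    exact h1.trans (hE n _)
  · intro n hn x
    obtain ⟨n, rfl⟩ := Nat.exists_eq_add_of_le' hn
    exact ⟨(L.norm_le_s n _).trans ((hD₁ n x).trans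
        ((le_max_left _ _).trans (le_max_right _ _))),
      (L.norm_le_s n _).trans ((hD₂ n x).trans ((le_max_right _ _).trans (le_max_right _ _)))⟩
  · set ρ := ν / (2 * (ν' + 1))
    have hρ : 0 < ρ := by positivity
    have hρ1 : ρ ≤ 1 := (div_le_one (by positivity)).2 (by linarith)
    -- With δ = 1 one has ‖x - y‖ ≤ μ_n^{-ε} ≤ 1, so the Lipschitz term is dominated by the Hölder
    -- term and contributes the summand 1.
    refine ⟨1 + 8 * greenConst θ ν * (2 * (T * M) + T * c) * (2 * N) ^ ρ, ρ, 1, by positivity, hρ,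
      one_pos, fun n hn x y hxy => ?_⟩
    obtain ⟨n, rfl⟩ := Nat.exists_eq_add_of_le' hn
    rw [one_mul] at hxy
    have hle := add_rpow_le_of_le_rpow_neg (H := 8 * greenConst θ ν * (2 * (T * M) + T * c))
      hN0.le (hμ1 (n + 1)) hε hρ.le hρ1 (norm_nonneg _) hxy
    exact ⟨(hh.norm_sub_le H hsmall hpert hzero hF hG n x y).trans hle,
      (hh'.norm_sub_le H hsmall hzero hpert hG hF n x y).trans hle⟩
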